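/- Let $G=(V,E)$ be a finite simple graph. Write $|G|$ for its geometric realization, and for an edge $\alpha$ and a map $f:|G|\to\mathbb R^2$ let $f(\alpha)$ be the image of the segment of $|G|$ corresponding to $\alpha$. Call $G$ a string graph if there are continuous curves $\gamma_v:[0,1]\to\mathbb R^2$ $(v\in V)$ such that for all $v\ne w$ in $V$ the images of $\gamma_v$ and $\gamma_w$ intersect if and only if $vw\in E$. Call $f:|G|\to\mathbb R^2$ piecewise linear in general position if (i) there is a finite subdivision of $|G|$ on each of whose edges $f$ is affine and no three distinct vertices of which are mapped by $f$ to one line, and (ii) for disjoint edges $\alpha,\beta$ of $G$, no point of $f(\alpha)\cap f(\beta)$ is the image of two distinct points of $\alpha$. Then $f(\alpha)\cap f(\beta)$ is finite for disjoint edges $\alpha,\beta$. Let $$P=P_s(G)=\{(\alpha,\beta)\in E^2 : vw\notin E\text{ for every }v\in\alpha,\ w\in\beta\}$$ (a symmetric set of pairs of disjoint edges). For $f$ piecewise linear in general position let $o_f\in(\mathbb Z/2)^P$ be given by $o_f(\alpha,\beta)=|f(\alpha)\cap f(\beta)| \bmod 2$. For $\omega\in E$ and $u\in V$ with $u\notin\omega$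 let $\phi_{\omega,u}\in(\mathbb Z/2)^P$ have the value $1$ at $(\alpha,\beta)$ if $\alpha=\omega$ and $u\in\beta$, or $\beta=\omega$ and $u\in\alpha$, and $0$ otherwise; let $\Phi$ be the set of all these vectors. The string obstruction of $G$ is the class of $o_f$ in $(\mathbb Z/2)^P/\operatorname{span}(\Phi)$, for any $f$ that is piecewise linear in general position. Theorem. If $G$ is a string graph, then its string obstruction vanishes: maps $f:|G|\to\mathbb R^2$ that are piecewise linear in general position exist, and $o_f\in\operatorname{span}(\Phi)$ for every such $f$. Moreover, there is a map $f:|G|\to\mathbb R^2$, piecewise linear in general position, such that $|f(\alpha)\cap f(\beta)|$ is even for every $(\alpha,\beta)\in P_s(G)$. -/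

import Mathlib

namespace StringObstruction

/-- The Euclidean plane. -/
abbrev Plane : Type := EuclideanSpace ℝ (Fin 2)

section Graph

variable {V : Type*}

/-- `G` is a string graph: there are curves `γ v` (images of continuous maps `[0,1] → ℝ²`), one for
each vertex, such that for `v ≠ w` the curves of `v` and `w` meet iff `vw` is an edge. -/
def IsStringGraph (G : SimpleGraph V) : Prop :=
  ∃ γ : V → C(unitInterval, Plane), ∀ v w : V, v ≠ w →
    ((Set.range (γ v) ∩ Set.range (γ w)).Nonempty ↔ G.Adj v w)

/-- `P_s(G)`: the ordered pairs of edges `(α, β)` such that no vertex of `α` is adjacent to a vertex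
of `β`. -/
def stringPairs (G : SimpleGraph V) : Set (Sym2 V × Sym2 V) :=
  {p | p.1 ∈ G.edgeSet ∧ p.2 ∈ G.edgeSet ∧ ∀ v ∈ p.1, ∀ w ∈ p.2, ¬ G.Adj v w}

/-- `P_s(G)` is symmetric. -/
theorem stringPairs_symm {G : SimpleGraph V} {α β : Sym2 V} (h : (α, β) ∈ stringPairs G) :
    (β, α) ∈ stringPairs G :=
  ⟨h.2.1, h.1, fun v hv w hw hvw => h.2.2 w hw v hv hvw.symm⟩

/-- The pairs in `P_s(G)` are pairs of disjoint edges. -/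
theorem stringPairs_disjoint {G : SimpleGraph V} {α β : Sym2 V} (h : (α, β) ∈ stringPairs G) :
    ∀ v ∈ α, v ∉ β := by
  intro v hv hvβ
  obtain ⟨w, rfl⟩ := Sym2.mem_iff_exists.mp hv
  exact h.2.2 w (Sym2.mem_mk_right v w) v hvβ (SimpleGraph.Adj.symm h.1)

/-! ### Finger moves -/

open Classical in
/-- The finger move vector `φ_{ω,u} ∈ (ℤ/2)^P`: its entry at `(α, β)` is `1` if `α = ω` and `u ∈ β`,
or if `β = ω` and `u ∈ α`, and `0` otherwise. -/
noncomputable def fingerMove (P : Set (Sym2 V × Sym2 V)) (ω : Sym2 V) (u : V) : P → ZMod 2 :=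
  fun p => if (p.1.1 = ω ∧ u ∈ p.1.2) ∨ (p.1.2 = ω ∧ u ∈ p.1.1) then 1 else 0

/-- The span over `ℤ/2` of all finger move vectors `φ_{ω,u}`, where `ω` is an edge of `G` and `u` is
a vertex not on `ω`. -/
noncomputable def fingerSpan (G : SimpleGraph V) (P : Set (Sym2 V × Sym2 V)) :
    Submodule (ZMod 2) (P → ZMod 2) :=
  Submodule.span (ZMod 2) {φ | ∃ ω ∈ G.edgeSet, ∃ u : V, u ∉ ω ∧ φ = fingerMove P ω u}

/-! ### The geometric realization and drawings

The geometric realization of a finite graph is taken in barycentric coordinates inside the standard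
simplex of `V → ℝ`. A map from the realization to the plane is a function `f : (V → ℝ) → Plane`, of
which only the values on the realization are ever used. -/

variable [Fintype V]

/-- The segment in the geometric realization that corresponds to the edge `e`: the points of the
standard simplex with barycentric coordinates supported on the endpoints of `e`. -/
def edgeSegment (e : Sym2 V) : Set (V → ℝ) :=
  {x | x ∈ stdSimplex ℝ V ∧ ∀ v, v ∉ e → x v = 0}

/-- The point of the geometric realization that corresponds to the vertex `v`. -/
def vertexPoint [DecidableEq V] (v : V) : V → ℝ := Pi.single v 1

/-- The geometric realization of `G`. -/
def realization [DecidableEq V] (G : SimpleGraph V) : Set (V → ℝ) :=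
  Set.range (vertexPoint (V := V)) ∪ ⋃ e ∈ G.edgeSet, edgeSegment e

/-- `f : |G| → ℝ²` is a piecewise linear map in general position: there is a subdivision of `G`, with
finite vertex set `S ⊆ |G|` containing the vertices of `G`, such that `f` is affine on every piece of
an edge with no point of `S` in its interior, and `f` takes no three distinct points of `S` to one
line. Moreover (so that the crossings of two disjoint edges are just the points that their images
share) an edge does not cross itself at a point lying on the image of an edge disjoint from it. -/
structure IsGeneralPL [DecidableEq V] (G : SimpleGraph V) (f : (V → ℝ) → Plane) : Prop where
  exists_subdivision : ∃ S : Set (V → ℝ), S.Finite ∧ S ⊆ realization G ∧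
    (∀ v : V, vertexPoint v ∈ S) ∧
    (∀ e ∈ G.edgeSet, ∀ x ∈ edgeSegment e, ∀ y ∈ edgeSegment e, Disjoint (openSegment ℝ x y) S →
      ∀ t ∈ Set.Icc (0 : ℝ) 1,
        f (AffineMap.lineMap x y t) = AffineMap.lineMap (f x) (f y) t) ∧
    (∀ a ∈ S, ∀ b ∈ S, ∀ c ∈ S, a ≠ b → a ≠ c → b ≠ c → ¬ Collinear ℝ {f a, f b, f c})
  no_self_crossing_on_disjoint : ∀ α ∈ G.edgeSet, ∀ β ∈ G.edgeSet, (∀ v ∈ α, v ∉ β) →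
    ∀ x ∈ edgeSegment α, ∀ x' ∈ edgeSegment α, ∀ y ∈ edgeSegment β,
      f x = f x' → f x = f y → x = x'

/-- The set `f(α) ∩ f(β)`. If `f` is piecewise linear in general position and `α`, `β` are disjoint
edges then it is finite. -/
def crossings (f : (V → ℝ) → Plane) (α β : Sym2 V) : Set Plane :=
  f '' edgeSegment α ∩ f '' edgeSegment β

/-- The vector `o_f ∈ (ℤ/2)^P`, `o_f(α, β) = |f(α) ∩ f(β)| mod 2`. -/
noncomputable def crossingVector (P : Set (Sym2 V × Sym2 V)) (f : (V → ℝ) → Plane) : P → ZMod 2 :=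
  fun p => ((crossings f p.1.1 p.1.2).ncard : ZMod 2)

/-- The class of `o_f` in `(ℤ/2)^P` modulo the span of the finger moves. -/
noncomputable def vanKampenClass (G : SimpleGraph V) (P : Set (Sym2 V × Sym2 V))
    (f : (V → ℝ) → Plane) : (P → ZMod 2) ⧸ fingerSpan G P :=
  Submodule.Quotient.mk (crossingVector P f)

/-- The mod 2 Van Kampen obstruction of `G` modified for `P` (a symmetric set of pairs of disjoint
edges) vanishes. The obstruction is the class of `o_f` for a piecewise linear `f` in general
position, whichever `f` is used; so it vanishes when there are such `f` and all of them have
class zero. -/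
def ObstructionVanishes [DecidableEq V] (G : SimpleGraph V) (P : Set (Sym2 V × Sym2 V)) : Prop :=
  (∃ f, IsGeneralPL G f) ∧ ∀ f, IsGeneralPL G f → vanKampenClass G P f = 0

end Graph

end StringObstruction

/-!
For maps in general position the crossing parities are computed without any homotopy. Fix a height
function, that is, a linear functional `h` that separates the images of the subdivision points. For
four points in general position, the segments `ab` and `cd` cross iff the parallelogram of the
differences of their points contains the origin, that is, iff its boundary crosses the positive
horizontal axis an odd number of times. This turns the crossing indicator of `ab` and `cd` into the
sum of the incidences of either segment with the horizontal rays from the endpoints of the other,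
plus comparisons of the heights of endpoints (`ind_crosses`). Summed over the pieces of two
polygonal paths, everything telescopes to the ends of the paths (`sum_ind_crosses`). So for disjoint
edges `α`, `β` the number `|f(α) ∩ f(β)|` is modulo 2 a sum of terms `c ω u`, one for each incidence
of `ω ∈ {α, β}` with an endpoint `u` of the other edge, plus a comparison of the height of each
vertex of `α` with that of each vertex of `β`. Up to further terms of the form `c ω u`, the latter
may be replaced by comparisons in an order of the vertices that is fixed once and for all
(`IsGeneralPL.exists_crossing_eq`). Hence for two maps in general position the difference of the
crossing vectors is a sum of terms `c ω u` only, and this is the combination of the finger moves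
`φ_{ω,u}` with the coefficients `c ω u` (`IsGeneralPL.crossingVector_sub_mem`).

It remains to find one map in general position with vanishing crossing vector. In a string graph an
edge `vw` can be drawn, as a curve from a point of the string of `v` to a point of the string of
`w`, inside the union of these two strings. For a pair in `stringPairs G` the strings of the
endpoints of one edge are disjoint from those of the other, hence at positive distance from them.
Sampling the curves on a fine grid, moving the sample points slightly to generic positions and
interpolating linearly gives a map in general position for which the images of such edges are still
disjoint (`IsStringGraph.exists_crossings_eq_empty`). Generic positions exist since the conditions
are the non-vanishing of finitely many analytic functions (`exists_isGeneric`).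
-/

namespace StringObstruction

/-! ### Orientation and crossings of segments in the plane -/

/-- Twice the signed area of the triangle `abc`. -/
def area (a b c : Plane) : ℝ :=
  (b 0 - a 0) * (c 1 - a 1) - (b 1 - a 1) * (c 0 - a 0)

theorem area_swap (a b c : Plane) : area b a c = -area a b c := by
  simp only [area]; ring

theorem area_left (a b : Plane) : area a b a = 0 := by
  simp only [area]; ring

theorem area_right (a b : Plane) : area a b b = 0 := by
  simp only [area]; ring

theorem lineMap_apply_coord (a b : Plane) (t : ℝ) (i : Fin 2) :
    (AffineMap.lineMap a b t : Plane) i = a i + t * (b i - a i) := by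
  simp [AffineMap.lineMap_apply]; ring

theorem area_lineMap (a b c d : Plane) (t : ℝ) :
    area a b (AffineMap.lineMap c d t) = (1 - t) * area a b c + t * area a b d := by
  simp only [area, lineMap_apply_coord]; ring

theorem area_lineMap_self (a b : Plane) (t : ℝ) : area a b (AffineMap.lineMap a b t) = 0 := by
  simp [area_lineMap, area_left, area_right]

theorem area_eq_zero_of_collinear {a b c : Plane} (h : Collinear ℝ {a, b, c}) :
    area a b c = 0 := by
  obtain ⟨v, hv⟩ := (collinear_iff_of_mem (p₀ := a) (by simp)).1 h
  obtain ⟨r, rfl⟩ := hv b (by simp)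
  obtain ⟨s, rfl⟩ := hv c (by simp)
  simp [area]; ring

theorem collinear_of_area_eq_zero {a b c : Plane} (h : area a b c = 0) :
    Collinear ℝ {a, b, c} := by
  by_cases hab : a = b
  · subst hab
    simpa using collinear_pair ℝ a c
  have hne : (b 0 - a 0) ^ 2 + (b 1 - a 1) ^ 2 ≠ 0 := by
    intro h0
    apply hab
    have h1 : b 0 - a 0 = 0 := by nlinarith [sq_nonneg (b 0 - a 0), sq_nonneg (b 1 - a 1)]
    have h2 : b 1 - a 1 = 0 := by nlinarith [sq_nonneg (b 0 - a 0), sq_nonneg (b 1 - a 1)]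
    ext i
    fin_cases i
    · simp; linarith
    · simp; linarith
  refine (collinear_iff_of_mem (p₀ := a) (by simp)).2 ⟨b - a, ?_⟩
  simp only [Set.mem_insert_iff, Set.mem_singleton_iff, forall_eq_or_imp, forall_eq]
  refine ⟨⟨0, by simp⟩, ⟨1, by simp⟩,
    ⟨((b 0 - a 0) * (c 0 - a 0) + (b 1 - a 1) * (c 1 - a 1)) /
      ((b 0 - a 0) ^ 2 + (b 1 - a 1) ^ 2), ?_⟩⟩
  simp only [area] at h
  ext i
  fin_cases i
  · simp
    field_simp
    linear_combination -(b 1 - a 1) * h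
  · simp
    field_simp
    linear_combination (b 0 - a 0) * h

/-- Two common points of the lines `ab` and `cd` coincide if the lines are not parallel, that is, if
`c` and `d` have different signed distances to `ab`. -/
theorem eq_of_area_eq_zero {a b c d z w : Plane} (h : area a b c ≠ area a b d)
    (hz : area a b z = 0) (hz' : area c d z = 0) (hw : area a b w = 0) (hw' : area c d w = 0) :
    z = w := by
  -- `K` is the determinant of the directions of the two lines
  have hK : (b 0 - a 0) * (d 1 - c 1) - (b 1 - a 1) * (d 0 - c 0) ≠ 0 := by
    intro h0; apply h; simp only [area]; linear_combination -h0
  simp only [area] at hz hz' hw hw'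
  ext i
  fin_cases i
  · apply mul_left_cancel₀ hK
    simp only [Fin.zero_eta]
    linear_combination (b 0 - a 0) * (hw' - hz') - (d 0 - c 0) * (hw - hz)
  · apply mul_left_cancel₀ hK
    simp only [Fin.mk_one]
    linear_combination (b 1 - a 1) * (hw' - hz') - (d 1 - c 1) * (hw - hz)

/-- The segments `ab` and `cd` cross, in terms of orientations. -/
def Crosses (a b c d : Plane) : Prop :=
  area a b c * area a b d < 0 ∧ area c d a * area c d b < 0

theorem area_mul_neg_of_mem {a b c d : Plane} {t : ℝ} (ht : t ∈ Set.Icc (0 : ℝ) 1)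
    (hc : area a b c ≠ 0) (hd : area a b d ≠ 0)
    (h : area a b (AffineMap.lineMap c d t) = 0) : area a b c * area a b d < 0 := by
  rw [area_lineMap] at h
  obtain ⟨h0, h1⟩ := ht
  rcases lt_or_gt_of_ne hc with hc | hc <;> rcases lt_or_gt_of_ne hd with hd | hd
  · rcases h0.eq_or_lt with rfl | h0 <;> nlinarith
  · exact mul_neg_of_neg_of_pos hc hd
  · exact mul_neg_of_pos_of_neg hc hd
  · rcases h0.eq_or_lt with rfl | h0 <;> nlinarith

theorem crosses_iff {a b c d : Plane} (hc : area a b c ≠ 0) (hd : area a b d ≠ 0)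
    (ha : area c d a ≠ 0) (hb : area c d b ≠ 0) :
    Crosses a b c d ↔ ∃ s ∈ Set.Icc (0 : ℝ) 1, ∃ t ∈ Set.Icc (0 : ℝ) 1,
      (AffineMap.lineMap a b s : Plane) = AffineMap.lineMap c d t := by
  have key : ∀ x y : ℝ, x * y < 0 → x / (x - y) ∈ Set.Icc (0 : ℝ) 1 ∧ x - y ≠ 0 := by
    intro x y hxy
    rcases mul_neg_iff.1 hxy with ⟨hx, hy⟩ | ⟨hx, hy⟩
    · have : 0 < x - y := by linarith
      exact ⟨⟨by positivity, by rw [div_le_one this]; linarith⟩, this.ne'⟩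
    · have : x - y < 0 := by linarith
      exact ⟨⟨div_nonneg_of_nonpos hx.le this.le, by rw [div_le_one_of_neg this]; linarith⟩,
        this.ne⟩
  constructor
  · rintro ⟨h1, h2⟩
    obtain ⟨ht, ht0⟩ := key _ _ h1
    obtain ⟨hs, hs0⟩ := key _ _ h2
    refine ⟨_, hs, _, ht, ?_⟩
    ext i
    rw [lineMap_apply_coord, lineMap_apply_coord]
    simp only [area] at ht0 hs0 ⊢
    field_simp
    fin_cases i <;> · simp; ring
  · rintro ⟨s, hs, t, ht, h⟩
    exact ⟨area_mul_neg_of_mem ht hc hd (h ▸ area_lineMap_self a b s),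
      area_mul_neg_of_mem hs ha hb (h ▸ area_lineMap_self c d t)⟩

/-! ### Ray crossings and the local parity identity -/

open Classical in
/-- The indicator of a proposition, with values in `ℤ/2`. -/
noncomputable def ind (p : Prop) : ZMod 2 := if p then 1 else 0

theorem ind_true {p : Prop} (h : p) : ind p = 1 := if_pos h

theorem ind_false {p : Prop} (h : ¬p) : ind p = 0 := if_neg h

theorem ind_congr {p q : Prop} (h : p ↔ q) : ind p = ind q := by rw [propext h]

/-- The segment `ab` meets the horizontal ray that starts at `p` and points to the right, where `h`
is the height function. -/
def MeetsRay (h : Plane → ℝ) (p a b : Plane) : Prop :=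
  (h a < h p ∧ h p < h b ∧ 0 < area a b p) ∨ (h b < h p ∧ h p < h a ∧ area a b p < 0)

theorem meetsRay_swap (h : Plane → ℝ) (p a b : Plane) :
    MeetsRay h p a b ↔ MeetsRay h p b a := by
  simp only [MeetsRay, area_swap a b, Left.neg_pos_iff, Left.neg_neg_iff]
  tauto

theorem ind_lt_swap {x y : ℝ} (h : x ≠ y) : ind (x < y) = ind (y < x) + 1 := by
  rcases lt_or_gt_of_ne h with h | h
  · rw [ind_true h, ind_false h.not_gt]; rfl
  · rw [ind_true h, ind_false h.not_gt]; rfl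

/-- The assertion of `ind_crosses` for the segments `ab` and `cd`. -/
def ParityIdentity (h : Plane → ℝ) (a b c d : Plane) : Prop :=
  ind (Crosses a b c d) =
    ind (MeetsRay h c a b) + ind (MeetsRay h d a b) + ind (MeetsRay h a c d) +
      ind (MeetsRay h b c d) +
      (ind (h a < h c) + ind (h a < h d) + ind (h b < h c) + ind (h b < h d))

theorem ParityIdentity.swap_left {h : Plane → ℝ} {a b c d : Plane}
    (H : ParityIdentity h a b c d) : ParityIdentity h b a c d := by
  have h1 : Crosses b a c d ↔ Crosses a b c d := by
    simp only [Crosses, area_swap a b, neg_mul_neg, mul_comm (area c d b)]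
  simp only [ParityIdentity, ind_congr h1, ind_congr (meetsRay_swap h _ b a)] at H ⊢
  rw [H]; ring

theorem ParityIdentity.swap_pairs {h : Plane → ℝ} {a b c d : Plane} (hac : h a ≠ h c)
    (had : h a ≠ h d) (hbc : h b ≠ h c) (hbd : h b ≠ h d)
    (H : ParityIdentity h a b c d) : ParityIdentity h c d a b := by
  have h1 : Crosses c d a b ↔ Crosses a b c d := and_comm
  simp only [ParityIdentity, ind_congr h1, ind_lt_swap hac, ind_lt_swap had, ind_lt_swap hbc,
    ind_lt_swap hbd] at H ⊢
  rw [H]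
  have h4 : (1 + 1 + 1 + 1 : ZMod 2) = 0 := by decide
  linear_combination h4

theorem ParityIdentity.swap_right {h : Plane → ℝ} {a b c d : Plane}
    (H : ParityIdentity h a b c d) : ParityIdentity h a b d c := by
  have h1 : Crosses a b d c ↔ Crosses a b c d := by
    simp only [Crosses, area_swap c d, neg_mul_neg, mul_comm (area a b d)]
  simp only [ParityIdentity, ind_congr h1, ind_congr (meetsRay_swap h _ d c)] at H ⊢
  rw [H]; ring

/-- The case of `ind_crosses` in which `a` is the lowest point and `c` is lower than `d`. There remain
three orders of the heights; for each of them a choice of signs of the four areas either satisfies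
the identity or contradicts the affine relation between the four points. -/
theorem parityIdentity_of_lowest (h : Plane →ₗ[ℝ] ℝ) {a b c d : Plane}
    (hc : area a b c ≠ 0) (hd : area a b d ≠ 0) (ha : area c d a ≠ 0) (hb : area c d b ≠ 0)
    (hab : h a < h b) (hac : h a < h c) (hcd : h c < h d) (hbc : h b ≠ h c) (hbd : h b ≠ h d) :
    ParityIdentity h a b c d := by
  -- the two coefficient identities of the affine relation between four points of the plane
  have e1 : area c d b - area c d a + area a b d - area a b c = 0 := by
    simp only [area]; ring
  have e2 : area c d b * h a - area c d a * h b + area a b d * h c - area a b c * h d = 0 := by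
    have hx : ∀ x : Plane, h x = x 0 * h (EuclideanSpace.single 0 1) +
        x 1 * h (EuclideanSpace.single 1 1) := by
      intro x
      have : x = x 0 • EuclideanSpace.single 0 (1 : ℝ) + x 1 • EuclideanSpace.single 1 (1 : ℝ) := by
        ext i; fin_cases i <;> simp
      conv_lhs => rw [this]
      simp
    rw [hx a, hx b, hx c, hx d]
    simp only [area]; ring
  unfold ParityIdentity Crosses MeetsRay
  generalize h a = xa at *
  generalize h b = xb at *
  generalize h c = xc at *
  generalize h d = xd at *
  generalize area a b c = p at *
  generalize area a b d = q at *
  generalize area c d a = r at *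
  generalize area c d b = s at *
  -- together with the signs below, used by the `simp` calls through the wildcard
  have two : (1 + 1 : ZMod 2) = 0 := by decide
  have e3 : r * (xb - xa) = q * (xc - xa) - p * (xd - xa) := by
    linear_combination xa * e1 - e2
  have split : ∀ x : ℝ, x ≠ 0 → (x < 0 ∧ ¬0 < x) ∨ (0 < x ∧ ¬x < 0) := fun x hx =>
    (lt_or_gt_of_ne hx).imp (fun h => ⟨h, h.not_gt⟩) fun h => ⟨h, h.not_gt⟩
  have h1 : xa < xd := hac.trans hcd
  have h2 := hab.not_gt
  have h3 := hac.not_gt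
  have h4 := h1.not_gt
  have h5 := hcd.not_gt
  rcases lt_or_gt_of_ne hbc with hbc | hbc
  · have h6 := hbc.not_gt
    have h7 := hbc.trans hcd
    have h8 := h7.not_gt
    rcases split p hc with ⟨hp, hp'⟩ | ⟨hp, hp'⟩ <;>
    rcases split q hd with ⟨hq, hq'⟩ | ⟨hq, hq'⟩ <;>
    rcases split r ha with ⟨hr, hr'⟩ | ⟨hr, hr'⟩ <;>
    rcases split s hb with ⟨hs, hs'⟩ | ⟨hs, hs'⟩ <;>
    first
    | (simp [ind, mul_neg_iff, *]; done)
    | nlinarith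
  have h6 := hbc.not_gt
  rcases lt_or_gt_of_ne hbd with hbd | hbd
  · have h8 := hbd.not_gt
    rcases split p hc with ⟨hp, hp'⟩ | ⟨hp, hp'⟩ <;>
    rcases split q hd with ⟨hq, hq'⟩ | ⟨hq, hq'⟩ <;>
    rcases split r ha with ⟨hr, hr'⟩ | ⟨hr, hr'⟩ <;>
    rcases split s hb with ⟨hs, hs'⟩ | ⟨hs, hs'⟩ <;>
    first
    | (simp [ind, mul_neg_iff, *]; done)
    | nlinarith
  · have h8 := hbd.not_gt
    rcases split p hc with ⟨hp, hp'⟩ | ⟨hp, hp'⟩ <;>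
    rcases split q hd with ⟨hq, hq'⟩ | ⟨hq, hq'⟩ <;>
    rcases split r ha with ⟨hr, hr'⟩ | ⟨hr, hr'⟩ <;>
    rcases split s hb with ⟨hs, hs'⟩ | ⟨hs, hs'⟩ <;>
    first
    | (simp [ind, mul_neg_iff, *]; done)
    | nlinarith

/-- For four points in general position, the parity of the number of crossings of the segments `ab`
and `cd` is the number of the incidences of either segment with the rays from the endpoints of the
other, up to a term that only depends on the order of the heights. This is the count of the times
that the boundary of the parallelogram of all differences of a point of `ab` and a point of `cd`
crosses the positive horizontal axis: it is odd iff the parallelogram contains the origin. -/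
theorem ind_crosses (h : Plane →ₗ[ℝ] ℝ) {a b c d : Plane}
    (hc : area a b c ≠ 0) (hd : area a b d ≠ 0) (ha : area c d a ≠ 0) (hb : area c d b ≠ 0)
    (hab : h a ≠ h b) (hac : h a ≠ h c) (had : h a ≠ h d) (hbc : h b ≠ h c) (hbd : h b ≠ h d)
    (hcd : h c ≠ h d) : ParityIdentity h a b c d := by
  have neg : ∀ {a b c : Plane}, area a b c ≠ 0 → area b a c ≠ 0 := fun h => by
    rwa [area_swap, neg_ne_zero]
  -- the lowest of the four points may be taken to be the first, and `c` to be lower than `d`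
  have step1 : ∀ {a b c d : Plane}, area a b c ≠ 0 → area a b d ≠ 0 → area c d a ≠ 0 →
      area c d b ≠ 0 → h a < h b → h a < h c → h a < h d → h b ≠ h c → h b ≠ h d → h c ≠ h d →
      ParityIdentity h a b c d := by
    intro a b c d hc hd ha hb hab hac had hbc hbd hcd
    rcases lt_or_gt_of_ne hcd with hcd | hcd
    · exact parityIdentity_of_lowest h hc hd ha hb hab hac hcd hbc hbd
    · exact (parityIdentity_of_lowest h hd hc (neg ha) (neg hb) hab had hcd hbd hbc).swap_right
  have low : ∀ {x y z w : ℝ}, x ≠ y → x ≠ z → x ≠ w → y ≠ z → y ≠ w → z ≠ w →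
      (x < y ∧ x < z ∧ x < w) ∨ (y < x ∧ y < z ∧ y < w) ∨ (z < w ∧ z < x ∧ z < y) ∨
        (w < z ∧ w < x ∧ w < y) := by
    intro x y z w _ _ _ _ _ _
    grind
  rcases low hab hac had hbc hbd hcd with ⟨h1, h2, h3⟩ | ⟨h1, h2, h3⟩ | ⟨h1, h2, h3⟩ | ⟨h1, h2, h3⟩
  · exact step1 hc hd ha hb h1 h2 h3 hbc hbd hcd
  · exact (step1 (neg hc) (neg hd) hb ha h1 h2 h3 hac had hcd).swap_left
  · exact (step1 ha hb hc hd h1 h2 h3 had.symm hbd.symm hab).swap_pairs hac.symm hbc.symm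
      had.symm hbd.symm
  · exact (step1 (neg ha) (neg hb) hd hc h1 h2 h3 hac.symm hbc.symm hab).swap_left.swap_pairs
      hac.symm hbc.symm had.symm hbd.symm

/-- A finite set of points of the plane is separated by some linear functional. -/
theorem exists_injOn_linear {F : Set Plane} (hF : F.Finite) :
    ∃ h : Plane →ₗ[ℝ] ℝ, Set.InjOn h F := by
  -- the functional `x ↦ x 0 + s * x 1` separates `p` and `q` for all but at most one `s`
  obtain ⟨s, hs⟩ := ((hF.prod hF).image
    fun q : Plane × Plane => -(q.1 0 - q.2 0) / (q.1 1 - q.2 1)).exists_notMem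
  refine ⟨(EuclideanSpace.proj 0 : Plane →L[ℝ] ℝ).toLinearMap +
    s • (EuclideanSpace.proj 1 : Plane →L[ℝ] ℝ).toLinearMap, fun p hp q hq hpq => ?_⟩
  simp at hpq
  have h1 : p 1 = q 1 := by
    by_contra h1
    refine hs ⟨(p, q), ⟨hp, hq⟩, ?_⟩
    have : p 1 - q 1 ≠ 0 := sub_ne_zero.2 h1
    simp only
    field_simp
    linarith
  ext i
  fin_cases i
  · simp only [h1] at hpq
    simp only [Fin.zero_eta]
    linarith
  · exact h1

/-! ### Crossings of polygonal paths -/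

theorem sum_range_add_succ (g : ℕ → ZMod 2) (m : ℕ) :
    ∑ i ∈ Finset.range m, (g i + g (i + 1)) = g 0 + g m := by
  have two : ∀ x : ZMod 2, x + x = 0 := CharTwo.add_self_eq_zero
  induction m with
  | zero => simp [two]
  | succ m ih => rw [Finset.sum_range_succ, ih]; linear_combination two (g m)

/-- The parity of the number of pieces of the polygonal path `a 0, …, a m` that meet the ray
from `p`. -/
noncomputable def rayParity (h : Plane → ℝ) (a : ℕ → Plane) (m : ℕ) (p : Plane) : ZMod 2 :=
  ∑ i ∈ Finset.range m, ind (MeetsRay h p (a i) (a (i + 1)))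

/-- The parity of the number of crossings of two polygonal paths in general position is determined
by the incidences of either path with the rays from the ends of the other, and by the heights of
the ends. -/
theorem sum_ind_crosses {h : Plane → ℝ} {a b : ℕ → Plane} {m n : ℕ}
    (H : ∀ i < m, ∀ j < n, ParityIdentity h (a i) (a (i + 1)) (b j) (b (j + 1))) :
    ∑ i ∈ Finset.range m, ∑ j ∈ Finset.range n, ind (Crosses (a i) (a (i + 1)) (b j) (b (j + 1))) =
      rayParity h a m (b 0) + rayParity h a m (b n) + rayParity h b n (a 0) +
        rayParity h b n (a m) +
        (ind (h (a 0) < h (b 0)) + ind (h (a 0) < h (b n)) + ind (h (a m) < h (b 0)) +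
          ind (h (a m) < h (b n))) := by
  have e : ∀ i ∈ Finset.range m, ∑ j ∈ Finset.range n,
      ind (Crosses (a i) (a (i + 1)) (b j) (b (j + 1))) =
      (ind (MeetsRay h (b 0) (a i) (a (i + 1))) + ind (MeetsRay h (b n) (a i) (a (i + 1)))) +
      ((rayParity h b n (a i) + (ind (h (a i) < h (b 0)) + ind (h (a i) < h (b n)))) +
        (rayParity h b n (a (i + 1)) +
          (ind (h (a (i + 1)) < h (b 0)) + ind (h (a (i + 1)) < h (b n))))) := by
    intro i hi
    simp only [← sum_range_add_succ (fun j => ind (MeetsRay h (b j) (a i) (a (i + 1)))),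
      ← sum_range_add_succ (fun j => ind (h (a i) < h (b j))),
      ← sum_range_add_succ (fun j => ind (h (a (i + 1)) < h (b j))), rayParity,
      ← Finset.sum_add_distrib]
    refine Finset.sum_congr rfl fun j hj => ?_
    rw [show ind _ = _ from H i (Finset.mem_range.1 hi) j (Finset.mem_range.1 hj)]
    ring
  rw [Finset.sum_congr rfl e, Finset.sum_add_distrib, Finset.sum_add_distrib,
    sum_range_add_succ (fun i =>
      rayParity h b n (a i) + (ind (h (a i) < h (b 0)) + ind (h (a i) < h (b n))))]
  simp only [rayParity]
  ring

/-! ### Parametrized edges and their subdivisions -/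

section Edges

variable {V : Type*}

/-- The first endpoint of an edge, for an arbitrary orientation of the edges. -/
noncomputable def src (e : Sym2 V) : V := (Quot.out e).1

/-- The second endpoint of an edge, for the orientation of `src`. -/
noncomputable def tgt (e : Sym2 V) : V := (Quot.out e).2

theorem mk_src_tgt (e : Sym2 V) : s(src e, tgt e) = e := Quot.out_eq e

theorem mem_iff_src_or_tgt {e : Sym2 V} {v : V} : v ∈ e ↔ v = src e ∨ v = tgt e := by
  conv_lhs => rw [← mk_src_tgt e]
  exact Sym2.mem_iff

theorem src_mem (e : Sym2 V) : src e ∈ e := mem_iff_src_or_tgt.2 (Or.inl rfl)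

theorem tgt_mem (e : Sym2 V) : tgt e ∈ e := mem_iff_src_or_tgt.2 (Or.inr rfl)

theorem src_ne_tgt {G : SimpleGraph V} {e : Sym2 V} (he : e ∈ G.edgeSet) : src e ≠ tgt e := by
  rw [← mk_src_tgt e] at he
  exact SimpleGraph.Adj.ne he

variable [DecidableEq V]

/-- The affine parametrization of the segment of an edge by `[0, 1]`. -/
noncomputable def edgePoint (e : Sym2 V) : ℝ →ᵃ[ℝ] (V → ℝ) :=
  AffineMap.lineMap (vertexPoint (src e)) (vertexPoint (tgt e))

theorem edgePoint_zero (e : Sym2 V) : edgePoint e 0 = vertexPoint (src e) := by simp [edgePoint]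

theorem edgePoint_one (e : Sym2 V) : edgePoint e 1 = vertexPoint (tgt e) := by simp [edgePoint]

theorem edgePoint_apply (e : Sym2 V) (t : ℝ) (v : V) :
    edgePoint e t v = (1 - t) * (if v = src e then 1 else 0) + t * (if v = tgt e then 1 else 0) := by
  simp [edgePoint, AffineMap.lineMap_apply, vertexPoint, Pi.single_apply]
  split_ifs <;> ring

theorem edgePoint_apply_tgt {e : Sym2 V} (h : src e ≠ tgt e) (t : ℝ) :
    edgePoint e t (tgt e) = t := by
  simp [edgePoint_apply, h.symm]

theorem edgePoint_injective {e : Sym2 V} (h : src e ≠ tgt e) :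
    Function.Injective (edgePoint e) := fun s t hst => by
  rw [← edgePoint_apply_tgt h s, hst, edgePoint_apply_tgt h]

theorem openSegment_edgePoint (e : Sym2 V) {s t : ℝ} (h : s < t) :
    openSegment ℝ (edgePoint e s) (edgePoint e t) = edgePoint e '' Set.Ioo s t := by
  rw [← openSegment_eq_Ioo h, image_openSegment]

theorem vertexPoint_injective : Function.Injective (vertexPoint : V → V → ℝ) := fun v w h => by
  by_contra hvw
  have := congrFun h v
  simp [vertexPoint, hvw] at this

variable [Fintype V]

theorem edgePoint_mem {e : Sym2 V} {t : ℝ} (ht : t ∈ Set.Icc (0 : ℝ) 1) :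
    edgePoint e t ∈ edgeSegment e := by
  refine ⟨?_, fun v hv => ?_⟩
  · have h := (convex_stdSimplex ℝ V).segment_subset (single_mem_stdSimplex ℝ (src e))
      (single_mem_stdSimplex ℝ (tgt e))
    rw [segment_eq_image_lineMap] at h
    exact h ⟨t, ht, rfl⟩
  · rw [mem_iff_src_or_tgt, not_or] at hv
    simp [edgePoint_apply, hv]

theorem exists_edgePoint_eq {e : Sym2 V} (h : src e ≠ tgt e) {x : V → ℝ}
    (hx : x ∈ edgeSegment e) : x (tgt e) ∈ Set.Icc (0 : ℝ) 1 ∧ edgePoint e (x (tgt e)) = x := by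
  obtain ⟨⟨h0, h1⟩, h2⟩ := hx
  have hsum : x (src e) + x (tgt e) = 1 := by
    rw [← h1, ← Finset.sum_pair h]
    refine Finset.sum_subset (Finset.subset_univ _) fun v _ hv => h2 v ?_
    simpa [mem_iff_src_or_tgt] using hv
  refine ⟨⟨h0 _, by linarith [h0 (src e)]⟩, ?_⟩
  ext v
  rw [edgePoint_apply]
  by_cases hs : v = src e
  · subst hs
    simp [h]; linarith
  by_cases ht : v = tgt e
  · subst ht
    simp [hs]
  · have : x v = 0 := h2 v (by rw [mem_iff_src_or_tgt]; tauto)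
    simp [hs, ht, this]

theorem ne_of_mem_edgeSegment {α β : Sym2 V} (h : ∀ v ∈ α, v ∉ β) {x y : V → ℝ}
    (hx : x ∈ edgeSegment α) (hy : y ∈ edgeSegment β) : x ≠ y := by
  rintro rfl
  have h0 : x = 0 := by
    ext v
    by_cases hv : v ∈ α
    · exact hy.2 v (h v hv)
    · exact hx.2 v hv
  have := hx.1.2
  simp [h0] at this

end Edges

/-- `0 = t 0 < t 1 < … < t n = 1` is the subdivision of `[0, 1]` at the points of `T`. -/
structure IsSubdivision (T : Set ℝ) (n : ℕ) (t : ℕ → ℝ) : Prop where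
  zero : t 0 = 0
  last : t n = 1
  lt_succ : ∀ i < n, t i < t (i + 1)
  mem : ∀ i ≤ n, t i ∈ T
  notMem : ∀ i < n, ∀ r ∈ Set.Ioo (t i) (t (i + 1)), r ∉ T

theorem IsSubdivision.le {T : Set ℝ} {n : ℕ} {t : ℕ → ℝ} (H : IsSubdivision T n t) {i j : ℕ}
    (hij : i ≤ j) (hj : j ≤ n) : t i ≤ t j := by
  induction j, hij using Nat.le_induction with
  | base => exact le_rfl
  | succ j hij ih => exact (ih (by omega)).trans (H.lt_succ j (by omega)).le

theorem IsSubdivision.mem_Icc {T : Set ℝ} {n : ℕ} {t : ℕ → ℝ} (H : IsSubdivision T n t) {i : ℕ}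
    (hi : i ≤ n) : t i ∈ Set.Icc (0 : ℝ) 1 :=
  ⟨H.zero ▸ H.le (Nat.zero_le i) hi, H.last ▸ H.le hi le_rfl⟩

theorem IsSubdivision.eq_of_mem_Ioo {T : Set ℝ} {n : ℕ} {t : ℕ → ℝ} (H : IsSubdivision T n t)
    {i j : ℕ} (hi : i < n) (hj : j < n) {r : ℝ} (hri : r ∈ Set.Ioo (t i) (t (i + 1)))
    (hrj : r ∈ Set.Ioo (t j) (t (j + 1))) : i = j := by
  rcases lt_trichotomy i j with h | h | h
  · have := H.le (show i + 1 ≤ j from h) hj.le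
    linarith [hri.2, hrj.1]
  · exact h
  · have := H.le (show j + 1 ≤ i from h) hi.le
    linarith [hrj.2, hri.1]

theorem IsSubdivision.exists_mem_Icc {T : Set ℝ} {n : ℕ} {t : ℕ → ℝ} (H : IsSubdivision T n t)
    {r : ℝ} (hr : r ∈ Set.Icc (0 : ℝ) 1) : ∃ i < n, r ∈ Set.Icc (t i) (t (i + 1)) := by
  have hn : n ≠ 0 := by
    rintro rfl
    exact zero_ne_one (H.zero.symm.trans H.last)
  by_contra! hcon
  have key : ∀ i < n, t i ≤ r := by
    intro i
    induction i with
    | zero => intro _; rw [H.zero]; exact hr.1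
    | succ i ih =>
      intro hi
      by_contra hlt
      exact hcon i (by omega) ⟨ih (by omega), (not_le.1 hlt).le⟩
  refine hcon (n - 1) (by omega) ⟨key _ (by omega), ?_⟩
  rw [Nat.sub_add_cancel (by omega), H.last]
  exact hr.2

theorem exists_isSubdivision {T : Set ℝ} (hT : (T ∩ Set.Icc 0 1).Finite) (h0 : (0 : ℝ) ∈ T)
    (h1 : (1 : ℝ) ∈ T) : ∃ n t, IsSubdivision T n t := by
  set U : Finset ℝ := hT.toFinset with hU
  have memU : ∀ x, x ∈ U ↔ x ∈ T ∧ x ∈ Set.Icc (0 : ℝ) 1 := by simp [hU]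
  have h0U : (0 : ℝ) ∈ U := (memU 0).2 ⟨h0, by simp⟩
  have h1U : (1 : ℝ) ∈ U := (memU 1).2 ⟨h1, by simp⟩
  obtain ⟨n, hn⟩ : ∃ n, U.card = n + 1 :=
    Nat.exists_eq_succ_of_ne_zero (Finset.card_pos.2 ⟨0, h0U⟩).ne'
  let g : Fin (n + 1) ↪o ℝ := U.orderEmbOfFin hn
  have gmem : ∀ i, g i ∈ U := U.orderEmbOfFin_mem hn
  have gsurj : ∀ x ∈ U, ∃ i, g i = x := fun x hx => by
    have : x ∈ Set.range g := by rw [U.range_orderEmbOfFin hn]; exact hx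
    exact this
  refine ⟨n, fun i => g (Fin.ofNat (n + 1) i), ?_, ?_, ?_, ?_, ?_⟩
  · obtain ⟨i, hi⟩ := gsurj 0 h0U
    refine le_antisymm (hi ▸ g.monotone (Fin.zero_le i)) ((memU _).1 (gmem _)).2.1
  · obtain ⟨i, hi⟩ := gsurj 1 h1U
    refine le_antisymm ((memU _).1 (gmem _)).2.2 (hi ▸ g.monotone ?_)
    rw [Fin.le_def]
    simp [Fin.ofNat]
    omega
  · intro i hi
    refine g.strictMono ?_
    rw [Fin.lt_def]
    simp [Fin.ofNat, Nat.mod_eq_of_lt (show i < n + 1 by omega),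
      Nat.mod_eq_of_lt (show i + 1 < n + 1 by omega)]
  · exact fun i _ => ((memU _).1 (gmem _)).1
  · rintro i hi r ⟨hr1, hr2⟩ hrT
    obtain ⟨j, rfl⟩ := gsurj r ((memU r).2
      ⟨hrT, ((memU _).1 (gmem _)).2.1.trans hr1.le, hr2.le.trans ((memU _).1 (gmem _)).2.2⟩)
    rw [g.lt_iff_lt, Fin.lt_def] at hr1 hr2
    simp [Fin.ofNat, Nat.mod_eq_of_lt (show i < n + 1 by omega),
      Nat.mod_eq_of_lt (show i + 1 < n + 1 by omega)] at hr1 hr2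
    omega

/-! ### The crossing vector modulo finger moves -/

section Invariance

theorem fingerMove_mem_fingerSpan {V : Type*} {G : SimpleGraph V} (ω : Sym2 V) (u : V) :
    fingerMove (stringPairs G) ω u ∈ fingerSpan G (stringPairs G) := by
  by_cases h : ω ∈ G.edgeSet ∧ u ∉ ω
  · exact Submodule.subset_span ⟨ω, h.1, u, h.2, rfl⟩
  · have : fingerMove (stringPairs G) ω u = 0 := by
      funext ⟨⟨α, β⟩, hp⟩
      refine if_neg ?_
      rintro (⟨rfl, hu⟩ | ⟨rfl, hu⟩)
      · exact h ⟨hp.1, fun h' => stringPairs_disjoint hp u h' hu⟩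
      · exact h ⟨hp.2.1, fun h' => stringPairs_disjoint hp u hu h'⟩
    rw [this]
    exact Submodule.zero_mem _

variable {V : Type*} [Fintype V] [DecidableEq V]

/-- `S` is the vertex set of a subdivision of the realization of `G` that witnesses that `f` is
piecewise linear in general position, apart from the condition on self-crossings. -/
structure IsGeneralSubdivision (G : SimpleGraph V) (f : (V → ℝ) → Plane) (S : Set (V → ℝ)) :
    Prop where
  finite : S.Finite
  vertex : ∀ v : V, vertexPoint v ∈ S
  affine : ∀ e ∈ G.edgeSet, ∀ x ∈ edgeSegment e, ∀ y ∈ edgeSegment e,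
    Disjoint (openSegment ℝ x y) S → ∀ t ∈ Set.Icc (0 : ℝ) 1,
      f (AffineMap.lineMap x y t) = AffineMap.lineMap (f x) (f y) t
  general : ∀ a ∈ S, ∀ b ∈ S, ∀ c ∈ S, a ≠ b → a ≠ c → b ≠ c → ¬ Collinear ℝ {f a, f b, f c}

theorem IsGeneralPL.exists_isGeneralSubdivision {G : SimpleGraph V} {f : (V → ℝ) → Plane}
    (hf : IsGeneralPL G f) : ∃ S, IsGeneralSubdivision G f S := by
  obtain ⟨S, h1, -, h2, h3, h4⟩ := hf.exists_subdivision
  exact ⟨S, h1, h2, h3, h4⟩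

variable {G : SimpleGraph V} {f : (V → ℝ) → Plane} {S : Set (V → ℝ)}

theorem IsGeneralSubdivision.area_ne_zero (hS : IsGeneralSubdivision G f S) {a b c : V → ℝ}
    (ha : a ∈ S) (hb : b ∈ S) (hc : c ∈ S) (hab : a ≠ b) (hac : a ≠ c) (hbc : b ≠ c) :
    area (f a) (f b) (f c) ≠ 0 :=
  fun h => hS.general a ha b hb c hc hab hac hbc (collinear_of_area_eq_zero h)

theorem IsGeneralSubdivision.exists_isSubdivision (hS : IsGeneralSubdivision G f S) {e : Sym2 V}
    (he : e ∈ G.edgeSet) : ∃ n t, IsSubdivision (edgePoint e ⁻¹' S) n t := by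
  refine StringObstruction.exists_isSubdivision
    (Set.Finite.subset (hS.finite.preimage (edgePoint_injective (src_ne_tgt he)).injOn)
      Set.inter_subset_left) ?_ ?_
  · rw [Set.mem_preimage, edgePoint_zero]; exact hS.vertex _
  · rw [Set.mem_preimage, edgePoint_one]; exact hS.vertex _

theorem IsGeneralSubdivision.apply_lineMap (hS : IsGeneralSubdivision G f S) {e : Sym2 V}
    (he : e ∈ G.edgeSet) {n : ℕ} {t : ℕ → ℝ} (ht : IsSubdivision (edgePoint e ⁻¹' S) n t) {i : ℕ}
    (hi : i < n) {s : ℝ} (hs : s ∈ Set.Icc (0 : ℝ) 1) :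
    f (edgePoint e (AffineMap.lineMap (t i) (t (i + 1)) s)) =
      AffineMap.lineMap (f (edgePoint e (t i))) (f (edgePoint e (t (i + 1)))) s := by
  rw [AffineMap.apply_lineMap]
  refine hS.affine e he _ (edgePoint_mem (ht.mem_Icc hi.le)) _ (edgePoint_mem (ht.mem_Icc hi)) ?_
    s hs
  rw [openSegment_edgePoint e (ht.lt_succ i hi), Set.disjoint_left]
  rintro _ ⟨r, hr, rfl⟩ hrS
  exact ht.notMem i hi r hr hrS

theorem lineMap_mem_Icc {a b s : ℝ} (hab : a ≤ b) (hs : s ∈ Set.Icc (0 : ℝ) 1) :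
    AffineMap.lineMap a b s ∈ Set.Icc a b := by
  rw [← segment_eq_Icc hab, segment_eq_image_lineMap]
  exact ⟨s, hs, rfl⟩

theorem exists_lineMap_eq {a b r : ℝ} (hab : a ≤ b) (hr : r ∈ Set.Icc a b) :
    ∃ s ∈ Set.Icc (0 : ℝ) 1, AffineMap.lineMap a b s = r := by
  rwa [← segment_eq_Icc hab, segment_eq_image_lineMap] at hr

/-- A point of an edge whose image lies on a piece of a disjoint edge is not a subdivision point. -/
theorem IsGeneralSubdivision.mem_Ioo (hS : IsGeneralSubdivision G f S) {α β : Sym2 V}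
    (hd : ∀ v ∈ α, v ∉ β) {m n : ℕ} {t u : ℕ → ℝ}
    (ht : IsSubdivision (edgePoint α ⁻¹' S) m t) (hβ : β ∈ G.edgeSet)
    (hu : IsSubdivision (edgePoint β ⁻¹' S) n u) {i j : ℕ} (hi : i < m) (hj : j < n) {r : ℝ}
    (hr : r ∈ Set.Icc (t i) (t (i + 1))) {s : ℝ}
    (h : f (edgePoint α r) =
      AffineMap.lineMap (f (edgePoint β (u j))) (f (edgePoint β (u (j + 1)))) s) :
    r ∈ Set.Ioo (t i) (t (i + 1)) := by
  have hnot : edgePoint α r ∉ S := by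
    intro hrS
    have hrI : edgePoint α r ∈ edgeSegment α := edgePoint_mem
      ⟨(ht.mem_Icc hi.le).1.trans hr.1, hr.2.trans (ht.mem_Icc (i := i + 1) hi).2⟩
    refine hS.area_ne_zero (hu.mem j hj.le) (hu.mem (j + 1) hj) hrS ?_ ?_ ?_
      (h ▸ area_lineMap_self _ _ s)
    · exact (edgePoint_injective (src_ne_tgt hβ)).ne (hu.lt_succ j hj).ne
    · exact (ne_of_mem_edgeSegment hd hrI (edgePoint_mem (hu.mem_Icc hj.le))).symm
    · exact (ne_of_mem_edgeSegment hd hrI (edgePoint_mem (hu.mem_Icc hj))).symm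
  refine ⟨lt_of_le_of_ne hr.1 ?_, lt_of_le_of_ne hr.2 ?_⟩
  · rintro rfl; exact hnot (ht.mem i hi.le)
  · rintro rfl; exact hnot (ht.mem (i + 1) hi)

/-- The common points of the images of two disjoint edges correspond to the crossing pairs of their
pieces. -/
theorem ncard_crossings (hf : IsGeneralPL G f) (hS : IsGeneralSubdivision G f S) {α β : Sym2 V}
    (hα : α ∈ G.edgeSet) (hβ : β ∈ G.edgeSet) (hd : ∀ v ∈ α, v ∉ β) {m n : ℕ} {t u : ℕ → ℝ}
    (ht : IsSubdivision (edgePoint α ⁻¹' S) m t) (hu : IsSubdivision (edgePoint β ⁻¹' S) n u)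
    {a b : ℕ → Plane} (ha : ∀ i, a i = f (edgePoint α (t i)))
    (hb : ∀ i, b i = f (edgePoint β (u i)))
    (H : ∀ i < m, ∀ j < n, area (a i) (a (i + 1)) (b j) ≠ 0 ∧
      area (a i) (a (i + 1)) (b (j + 1)) ≠ 0 ∧ area (b j) (b (j + 1)) (a i) ≠ 0 ∧
      area (b j) (b (j + 1)) (a (i + 1)) ≠ 0) :
    ((crossings f α β).ncard : ZMod 2) = ∑ i ∈ Finset.range m, ∑ j ∈ Finset.range n,
      ind (Crosses (a i) (a (i + 1)) (b j) (b (j + 1))) := by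
  classical
  have hd' : ∀ v ∈ β, v ∉ α := fun v h1 h2 => hd v h2 h1
  set F : Finset (ℕ × ℕ) := {p ∈ Finset.range m ×ˢ Finset.range n |
    Crosses (a p.1) (a (p.1 + 1)) (b p.2) (b (p.2 + 1))} with hF
  have hFcard : ∑ i ∈ Finset.range m, ∑ j ∈ Finset.range n,
      ind (Crosses (a i) (a (i + 1)) (b j) (b (j + 1))) = (F.card : ZMod 2) := by
    rw [← Finset.sum_product', hF, Finset.natCast_card_filter]
    exact Finset.sum_congr rfl fun p _ => by simp [ind]
  -- the pairs of parameters of a common point of two pieces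
  have hpt : ∀ p : ℕ × ℕ, ∃ q : ℝ × ℝ, p ∈ F → f (edgePoint α q.1) = f (edgePoint β q.2) ∧
      q.1 ∈ Set.Ioo (t p.1) (t (p.1 + 1)) ∧ q.2 ∈ Set.Ioo (u p.2) (u (p.2 + 1)) := by
    intro p
    by_cases hp : p ∈ F
    swap
    · exact ⟨0, fun h => absurd h hp⟩
    simp only [hF, Finset.mem_filter, Finset.mem_product, Finset.mem_range] at hp
    obtain ⟨⟨hi, hj⟩, hc⟩ := hp
    obtain ⟨h1, h2, h3, h4⟩ := H _ hi _ hj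
    obtain ⟨x, hx, y, hy, hxy⟩ := (crosses_iff h1 h2 h3 h4).1 hc
    simp only [ha, hb] at hxy
    have ex := hS.apply_lineMap hα ht hi hx
    have ey := hS.apply_lineMap hβ hu hj hy
    refine ⟨(AffineMap.lineMap (t p.1) (t (p.1 + 1)) x, AffineMap.lineMap (u p.2) (u (p.2 + 1)) y),
      fun _ => ⟨by rw [ex, ey, hxy], ?_, ?_⟩⟩
    · exact hS.mem_Ioo hd ht hβ hu hi hj (lineMap_mem_Icc (ht.lt_succ _ hi).le hx) (ex.trans hxy)
    · exact hS.mem_Ioo hd' hu hα ht hj hi (lineMap_mem_Icc (hu.lt_succ _ hj).le hy)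
        (ey.trans hxy.symm)
  choose q hq using hpt
  have hFlt : ∀ p ∈ F, p.1 < m ∧ p.2 < n := fun p hp => by
    simp only [hF, Finset.mem_filter, Finset.mem_product, Finset.mem_range] at hp
    exact hp.1
  have hqα : ∀ p ∈ F, edgePoint α (q p).1 ∈ edgeSegment α := fun p hp => edgePoint_mem
    ⟨(ht.mem_Icc (hFlt p hp).1.le).1.trans (hq p hp).2.1.1.le,
      (hq p hp).2.1.2.le.trans (ht.mem_Icc (i := p.1 + 1) (hFlt p hp).1).2⟩
  have hqβ : ∀ p ∈ F, edgePoint β (q p).2 ∈ edgeSegment β := fun p hp => edgePoint_mem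
    ⟨(hu.mem_Icc (hFlt p hp).2.le).1.trans (hq p hp).2.2.1.le,
      (hq p hp).2.2.2.le.trans (hu.mem_Icc (i := p.2 + 1) (hFlt p hp).2).2⟩
  have himage : crossings f α β = (fun p => f (edgePoint α (q p).1)) '' (F : Set (ℕ × ℕ)) := by
    ext z
    constructor
    · rintro ⟨⟨x, hx, hxz⟩, ⟨y, hy, hyz⟩⟩
      obtain ⟨hx1, hx2⟩ := exists_edgePoint_eq (src_ne_tgt hα) hx
      obtain ⟨hy1, hy2⟩ := exists_edgePoint_eq (src_ne_tgt hβ) hy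
      obtain ⟨i, hi, hxi⟩ := ht.exists_mem_Icc hx1
      obtain ⟨j, hj, hyj⟩ := hu.exists_mem_Icc hy1
      obtain ⟨r, hr, hr'⟩ := exists_lineMap_eq (ht.lt_succ i hi).le hxi
      obtain ⟨s, hs, hs'⟩ := exists_lineMap_eq (hu.lt_succ j hj).le hyj
      have e1 := hS.apply_lineMap hα ht hi hr
      have e2 := hS.apply_lineMap hβ hu hj hs
      rw [hr', hx2, hxz, ← ha, ← ha] at e1
      rw [hs', hy2, hyz, ← hb, ← hb] at e2
      obtain ⟨h1, h2, h3, h4⟩ := H _ hi _ hj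
      have hc : Crosses (a i) (a (i + 1)) (b j) (b (j + 1)) :=
        (crosses_iff h1 h2 h3 h4).2 ⟨r, hr, s, hs, e1.symm.trans e2⟩
      have hp : (i, j) ∈ F := by simp [hF, hi, hj, hc]
      refine ⟨(i, j), hp, ?_⟩
      obtain ⟨k1, k2, k3⟩ := hq _ hp
      obtain ⟨r', hr', hr''⟩ := exists_lineMap_eq (ht.lt_succ i hi).le ⟨k2.1.le, k2.2.le⟩
      obtain ⟨s', hs', hs''⟩ := exists_lineMap_eq (hu.lt_succ j hj).le ⟨k3.1.le, k3.2.le⟩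
      have e3 := hS.apply_lineMap hα ht hi hr'
      have e4 := hS.apply_lineMap hβ hu hj hs'
      rw [hr'', ← ha, ← ha] at e3
      rw [hs'', ← k1, ← hb, ← hb] at e4
      refine eq_of_area_eq_zero (a := a i) (b := a (i + 1)) (c := b j) (d := b (j + 1)) ?_
        (by simp only [e3]; exact area_lineMap_self _ _ _)
        (by simp only [e4]; exact area_lineMap_self _ _ _)
        (e1 ▸ area_lineMap_self _ _ _) (e2 ▸ area_lineMap_self _ _ _)
      intro h
      have := hc.1
      rw [h] at this
      nlinarith [mul_self_nonneg (area (a i) (a (i + 1)) (b (j + 1)))]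
    · rintro ⟨p, hp, rfl⟩
      exact ⟨⟨_, hqα p hp, rfl⟩, ⟨_, hqβ p hp, (hq p hp).1.symm⟩⟩
  have hinj : Set.InjOn (fun p => f (edgePoint α (q p).1)) (F : Set (ℕ × ℕ)) := by
    intro p hp p' hp' h
    have hp := Finset.mem_coe.1 hp
    have hp' := Finset.mem_coe.1 hp'
    simp only at h
    have h1 := hf.no_self_crossing_on_disjoint α hα β hβ hd _ (hqα p hp) _ (hqα p' hp') _
      (hqβ p hp) h (hq p hp).1
    have h2 := hf.no_self_crossing_on_disjoint β hβ α hα hd' _ (hqβ p hp) _ (hqβ p' hp') _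
      (hqα p hp) (by rw [← (hq p hp).1, ← (hq p' hp').1, h]) (hq p hp).1.symm
    have h3 := edgePoint_injective (src_ne_tgt hα) h1
    have h4 := edgePoint_injective (src_ne_tgt hβ) h2
    refine Prod.ext ?_ ?_
    · exact ht.eq_of_mem_Ioo (hFlt p hp).1 (hFlt p' hp').1 (hq p hp).2.1 (h3 ▸ (hq p' hp').2.1)
    · exact hu.eq_of_mem_Ioo (hFlt p hp).2 (hFlt p' hp').2 (hq p hp).2.2 (h4 ▸ (hq p' hp').2.2)
  rw [hFcard, himage, hinj.ncard_image, Set.ncard_coe_finset]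

theorem ne_of_area_ne_zero {a b c : Plane} (h : area a b c ≠ 0) : a ≠ b ∧ a ≠ c ∧ b ≠ c := by
  refine ⟨?_, ?_, ?_⟩
  · rintro rfl; exact h (by simp [area])
  · rintro rfl; exact h (area_left _ _)
  · rintro rfl; exact h (area_right _ _)

/-- Replacing the comparison of two heights by the comparison of the values of a fixed injective
function of the vertices costs a correction that splits symmetrically. -/
theorem ind_lt_eq {x y : ℝ} {k l : ℕ} (hxy : x ≠ y) (hkl : k ≠ l) :
    ind (x < y) = ind (k < l ∧ x < y) + ind (l < k ∧ y < x) + ind (l < k) := by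
  rcases lt_or_gt_of_ne hkl with h | h
  · simp [ind, h, h.not_gt]
  · rcases lt_or_gt_of_ne hxy with h' | h' <;> simp [ind, h, h.not_gt, h', h'.not_gt]
    decide

/-- The part of the crossing parities of disjoint edges that does not depend on the map. -/
noncomputable def orderParity (k : V → ℕ) (α β : Sym2 V) : ZMod 2 :=
  ind (k (src β) < k (src α)) + ind (k (tgt β) < k (src α)) + ind (k (src β) < k (tgt α)) +
    ind (k (tgt β) < k (tgt α))

/-- Up to a term independent of `f`, the crossing parities of `f` are a sum of terms that depend on
one edge and one vertex only. -/
theorem IsGeneralPL.exists_crossing_eq (hf : IsGeneralPL G f) {k : V → ℕ}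
    (hk : Function.Injective k) : ∃ c : Sym2 V → V → ZMod 2, ∀ α ∈ G.edgeSet, ∀ β ∈ G.edgeSet,
      (∀ v ∈ α, v ∉ β) → ((crossings f α β).ncard : ZMod 2) =
        c α (src β) + c α (tgt β) + c β (src α) + c β (tgt α) + orderParity k α β := by
  obtain ⟨S, hS⟩ := hf.exists_isGeneralSubdivision
  obtain ⟨h, hh⟩ := exists_injOn_linear (hS.finite.image f)
  have hsub : ∀ e : Sym2 V, ∃ (n : ℕ) (t : ℕ → ℝ), e ∈ G.edgeSet →
      IsSubdivision (edgePoint e ⁻¹' S) n t := fun e => by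
    by_cases he : e ∈ G.edgeSet
    · obtain ⟨n, t, ht⟩ := hS.exists_isSubdivision he
      exact ⟨n, t, fun _ => ht⟩
    · exact ⟨0, 0, fun h => absurd h he⟩
  choose n t ht using hsub
  let κ : V → V → ZMod 2 := fun v w =>
    ind (k v < k w ∧ h (f (vertexPoint v)) < h (f (vertexPoint w)))
  refine ⟨fun e v => rayParity h (fun i => f (edgePoint e (t e i))) (n e) (f (vertexPoint v)) +
    (κ (src e) v + κ (tgt e) v), fun α hα β hβ hd => ?_⟩
  have hd' : ∀ v ∈ β, v ∉ α := fun v h1 h2 => hd v h2 h1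
  -- three subdivision points, two of them on one edge and the third on the other
  have harea : ∀ {α β : Sym2 V}, α ∈ G.edgeSet → β ∈ G.edgeSet → (∀ v ∈ α, v ∉ β) →
      ∀ i < n α, ∀ j ≤ n β, area (f (edgePoint α (t α i))) (f (edgePoint α (t α (i + 1))))
        (f (edgePoint β (t β j))) ≠ 0 := by
    intro α β hα hβ hd i hi j hj
    refine hS.area_ne_zero ((ht α hα).mem i hi.le) ((ht α hα).mem (i + 1) hi)
      ((ht β hβ).mem j hj) ?_ ?_ ?_
    · exact (edgePoint_injective (src_ne_tgt hα)).ne ((ht α hα).lt_succ i hi).ne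
    · exact ne_of_mem_edgeSegment hd (edgePoint_mem ((ht α hα).mem_Icc hi.le))
        (edgePoint_mem ((ht β hβ).mem_Icc hj))
    · exact ne_of_mem_edgeSegment hd (edgePoint_mem ((ht α hα).mem_Icc hi))
        (edgePoint_mem ((ht β hβ).mem_Icc hj))
  have hheight : ∀ {x y : V → ℝ}, x ∈ S → y ∈ S → f x ≠ f y → h (f x) ≠ h (f y) :=
    fun hx hy hne he => hne (hh ⟨_, hx, rfl⟩ ⟨_, hy, rfl⟩ he)
  rw [ncard_crossings hf hS hα hβ hd (ht α hα) (ht β hβ) (fun _ => rfl) (fun _ => rfl)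
    fun i hi j hj => ⟨harea hα hβ hd i hi j hj.le, harea hα hβ hd i hi (j + 1) hj,
      harea hβ hα hd' j hj i hi.le, harea hβ hα hd' j hj (i + 1) hi⟩]
  rw [sum_ind_crosses (h := h) (a := fun i => f (edgePoint α (t α i)))
    (b := fun j => f (edgePoint β (t β j)))]
  · have hvert : ∀ v ∈ α, ∀ w ∈ β,
        ind (h (f (vertexPoint v)) < h (f (vertexPoint w))) = κ v w + κ w v + ind (k w < k v) := by
      intro v hv w hw
      refine ind_lt_eq (hheight (hS.vertex v) (hS.vertex w) ?_) (hk.ne fun h => hd v hv (h ▸ hw))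
      obtain ⟨v', rfl⟩ := Sym2.mem_iff_exists.1 hv
      refine (ne_of_area_ne_zero (hS.area_ne_zero (hS.vertex v) (hS.vertex v') (hS.vertex w)
        (vertexPoint_injective.ne (SimpleGraph.Adj.ne hα)) (vertexPoint_injective.ne ?_)
        (vertexPoint_injective.ne ?_))).2.1
      · exact fun h => hd v hv (h ▸ hw)
      · exact fun h => hd v' (Sym2.mem_mk_right v v') (h ▸ hw)
    simp only [(ht α hα).zero, (ht α hα).last, (ht β hβ).zero, (ht β hβ).last, edgePoint_zero,
      edgePoint_one, hvert _ (src_mem α) _ (src_mem β), hvert _ (src_mem α) _ (tgt_mem β),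
      hvert _ (tgt_mem α) _ (src_mem β), hvert _ (tgt_mem α) _ (tgt_mem β), orderParity]
    ring
  · intro i hi j hj
    have h1 := harea hα hβ hd i hi j hj.le
    have h2 := harea hα hβ hd i hi (j + 1) hj
    have h3 := harea hβ hα hd' j hj i hi.le
    have h4 := harea hβ hα hd' j hj (i + 1) hi
    have a0 := (ht α hα).mem i hi.le
    have a1 := (ht α hα).mem (i + 1) hi
    have b0 := (ht β hβ).mem j hj.le
    have b1 := (ht β hβ).mem (j + 1) hj
    obtain ⟨k1, k2, k3⟩ := ne_of_area_ne_zero h1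
    obtain ⟨-, k4, k5⟩ := ne_of_area_ne_zero h2
    exact ind_crosses h h1 h2 h3 h4 (hheight a0 a1 k1) (hheight a0 b0 k2) (hheight a0 b1 k4)
      (hheight a1 b0 k3) (hheight a1 b1 k5) (hheight b0 b1 (ne_of_area_ne_zero h3).1)

theorem sum_ite_mem (g : V → ZMod 2) {β : Sym2 V} (hβ : src β ≠ tgt β) :
    ∑ u : V, (if u ∈ β then g u else 0) = g (src β) + g (tgt β) := by
  rw [← Finset.sum_pair hβ, ← Finset.sum_filter]
  refine Finset.sum_congr ?_ fun _ _ => rfl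
  ext u
  simp [mem_iff_src_or_tgt]

/-- A vector whose entries are symmetric sums over the incidences of one edge with the endpoints of
the other is a combination of finger moves. -/
theorem mem_fingerSpan_of_eq {o : stringPairs G → ZMod 2} {c : Sym2 V → V → ZMod 2}
    (h : ∀ p, o p = c p.1.1 (src p.1.2) + c p.1.1 (tgt p.1.2) + c p.1.2 (src p.1.1) +
      c p.1.2 (tgt p.1.1)) : o ∈ fingerSpan G (stringPairs G) := by
  classical
  have : o = ∑ ω : Sym2 V, ∑ u : V, c ω u • fingerMove (stringPairs G) ω u := by
    funext p
    obtain ⟨⟨α, β⟩, hp⟩ := p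
    have hterm : ∀ ω u, c ω u * fingerMove (stringPairs G) ω u ⟨(α, β), hp⟩ =
        (if α = ω then if u ∈ β then c ω u else 0 else 0) +
          (if β = ω then if u ∈ α then c ω u else 0 else 0) := by
      intro ω u
      have hne : ¬(α = ω ∧ β = ω) := by
        rintro ⟨rfl, rfl⟩
        exact stringPairs_disjoint hp _ (src_mem _) (src_mem _)
      simp only [fingerMove]
      by_cases h1 : α = ω <;> by_cases h2 : β = ω <;> by_cases h3 : u ∈ α <;>
        by_cases h4 : u ∈ β <;> simp_all
    simp only [Finset.sum_apply, Pi.smul_apply, smul_eq_mul, hterm, Finset.sum_add_distrib]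
    rw [Finset.sum_comm, Finset.sum_comm (f := fun ω u => if β = ω then _ else _)]
    simp only [Finset.sum_ite_eq, Finset.mem_univ, if_true]
    rw [sum_ite_mem _ (src_ne_tgt hp.2.1), sum_ite_mem _ (src_ne_tgt hp.1), h]
    ring
  rw [this]
  exact Submodule.sum_mem _ fun ω _ => Submodule.sum_mem _ fun u _ =>
    Submodule.smul_mem _ _ (fingerMove_mem_fingerSpan ω u)

/-- The crossing vectors of any two maps in general position differ by finger moves. -/
theorem IsGeneralPL.crossingVector_sub_mem {g : (V → ℝ) → Plane} (hf : IsGeneralPL G f)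
    (hg : IsGeneralPL G g) :
    crossingVector (stringPairs G) f - crossingVector (stringPairs G) g ∈
      fingerSpan G (stringPairs G) := by
  have hk : Function.Injective fun v => (Fintype.equivFin V v : ℕ) :=
    Fin.val_injective.comp (Fintype.equivFin V).injective
  obtain ⟨c, hc⟩ := hf.exists_crossing_eq hk
  obtain ⟨c', hc'⟩ := hg.exists_crossing_eq hk
  refine mem_fingerSpan_of_eq (c := c - c') ?_
  rintro ⟨⟨α, β⟩, hp⟩
  simp only [Pi.sub_apply, crossingVector]
  rw [hc α hp.1 β hp.2.1 (stringPairs_disjoint hp), hc' α hp.1 β hp.2.1 (stringPairs_disjoint hp)]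
  ring

end Invariance

/-! ### Generic configurations of points -/

section Generic

variable {ι : Type*} [Fintype ι]

/-- The determinant of the coefficients of the equations of the lines `ab`, `cd` and `eg`. It vanishes
if the lines have a common point. -/
def concurrence (a b c d e g : Plane) : ℝ :=
  Matrix.det !![a 1 - b 1, b 0 - a 0, a 0 * b 1 - a 1 * b 0;
    c 1 - d 1, d 0 - c 0, c 0 * d 1 - c 1 * d 0;
    e 1 - g 1, g 0 - e 0, e 0 * g 1 - e 1 * g 0]

theorem concurrence_eq_zero {a b c d e g z : Plane} (h1 : area a b z = 0) (h2 : area c d z = 0)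
    (h3 : area e g z = 0) : concurrence a b c d e g = 0 := by
  simp only [area] at h1 h2 h3
  simp [concurrence, Matrix.det_fin_three]
  -- expansion along the last column, which is minus a combination of the first two up to the areas
  linear_combination
    ((c 1 - d 1) * (g 0 - e 0) - (d 0 - c 0) * (e 1 - g 1)) * h1
    - ((a 1 - b 1) * (g 0 - e 0) - (b 0 - a 0) * (e 1 - g 1)) * h2
    + ((a 1 - b 1) * (d 0 - c 0) - (b 0 - a 0) * (c 1 - d 1)) * h3

theorem analyticOnNhd_coord (i : ι) (k : Fin 2) :
    AnalyticOnNhd ℝ (fun P : ι → Plane => P i k) Set.univ := fun P _ =>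
  ((EuclideanSpace.proj k : Plane →L[ℝ] ℝ).comp
    (ContinuousLinearMap.proj i : (ι → Plane) →L[ℝ] Plane)).analyticAt P

/-- A condition `F P ≠ 0` with `F` analytic holds on a dense open set if it holds somewhere. -/
theorem isOpen_dense_ne_zero {F : (ι → Plane) → ℝ} (hF : AnalyticOnNhd ℝ F Set.univ)
    {Q : ι → Plane} (hQ : F Q ≠ 0) : IsOpen {P | F P ≠ 0} ∧ Dense {P | F P ≠ 0} := by
  refine ⟨isOpen_ne_fun (continuousOn_univ.1 hF.continuousOn) continuous_const, ?_⟩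
  intro P
  by_contra hP
  have h0 : F =ᶠ[nhds P] 0 := by
    filter_upwards [isClosed_closure.isOpen_compl.mem_nhds hP] with R hR
    by_contra h
    exact hR (subset_closure h)
  exact hQ (hF.eqOn_zero_of_preconnected_of_eventuallyEq_zero isPreconnected_univ
    (Set.mem_univ P) h0 (Set.mem_univ Q))

theorem isOpen_dense_area {i j k : ι} (h : [i, j, k].Nodup) :
    IsOpen {P : ι → Plane | area (P i) (P j) (P k) ≠ 0} ∧
      Dense {P : ι → Plane | area (P i) (P j) (P k) ≠ 0} := by
  classical
  refine isOpen_dense_ne_zero (Q := fun l => if l = i then !₂[0, 0] else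
    if l = j then !₂[1, 0] else !₂[0, 1]) ?_ ?_
  · have h := analyticOnNhd_coord (ι := ι)
    exact (((h j 0).sub (h i 0)).mul ((h k 1).sub (h i 1))).sub
      (((h j 1).sub (h i 1)).mul ((h k 0).sub (h i 0)))
  · simp at h
    obtain ⟨⟨h1, h2⟩, h3⟩ := h
    simp [area, Ne.symm h1, Ne.symm h2, Ne.symm h3]

theorem isOpen_dense_concurrence {a b c d e g : ι} (h : [a, b, c, d, e, g].Nodup) :
    IsOpen {P : ι → Plane | concurrence (P a) (P b) (P c) (P d) (P e) (P g) ≠ 0} ∧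
      Dense {P : ι → Plane | concurrence (P a) (P b) (P c) (P d) (P e) (P g) ≠ 0} := by
  classical
  -- the lines `y = 0`, `x = 0` and `x + y = 1`
  refine isOpen_dense_ne_zero (Q := fun l => if l = a then !₂[0, 0] else
    if l = b then !₂[1, 0] else if l = c then !₂[0, 0] else if l = d then !₂[0, 1] else
    if l = e then !₂[1, 0] else !₂[0, 1]) ?_ ?_
  · have h := analyticOnNhd_coord (ι := ι)
    have hA := fun i j => (h i 1).sub (h j 1)
    have hB := fun i j => (h j 0).sub (h i 0)
    have hC := fun i j => ((h i 0).mul (h j 1)).sub ((h i 1).mul (h j 0))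
    simp only [concurrence, Matrix.det_fin_three]
    exact (((((((hA a b).mul (hB c d)).mul (hC e g)).sub (((hA a b).mul (hC c d)).mul (hB e g))).sub
      (((hB a b).mul (hA c d)).mul (hC e g))).add (((hB a b).mul (hC c d)).mul (hA e g))).add
      (((hC a b).mul (hA c d)).mul (hB e g))).sub (((hC a b).mul (hB c d)).mul (hA e g))
  · simp at h
    obtain ⟨⟨h1, h2, h3, h4, h5⟩, ⟨h6, h7, h8, h9⟩, ⟨h10, h11, h12⟩, ⟨h13, h14⟩, h15⟩ := h
    simp [concurrence, Matrix.det_fin_three, Ne.symm h1, Ne.symm h2, Ne.symm h3, Ne.symm h4,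
      Ne.symm h5, Ne.symm h6, Ne.symm h7, Ne.symm h8, Ne.symm h9, Ne.symm h10, Ne.symm h11,
      Ne.symm h12, Ne.symm h13, Ne.symm h14, Ne.symm h15]

/-- No three points of the family are collinear, and no three lines through disjoint pairs of its
points have a common point. -/
structure IsGeneric (P : ι → Plane) : Prop where
  area_ne_zero : ∀ i j k, [i, j, k].Nodup → area (P i) (P j) (P k) ≠ 0
  concurrence_ne_zero : ∀ a b c d e g, [a, b, c, d, e, g].Nodup →
    concurrence (P a) (P b) (P c) (P d) (P e) (P g) ≠ 0

/-- Every family of points can be moved by less than `ε` to a generic one. -/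
theorem exists_isGeneric (Q : ι → Plane) {ε : ℝ} (hε : 0 < ε) :
    ∃ P, IsGeneric P ∧ ∀ i, dist (P i) (Q i) < ε := by
  have h1 : ∀ p : ι × ι × ι, IsOpen {P : ι → Plane | [p.1, p.2.1, p.2.2].Nodup →
      area (P p.1) (P p.2.1) (P p.2.2) ≠ 0} ∧ Dense {P : ι → Plane |
        [p.1, p.2.1, p.2.2].Nodup → area (P p.1) (P p.2.1) (P p.2.2) ≠ 0} := by
    rintro ⟨i, j, k⟩
    by_cases h : [i, j, k].Nodup
    · simpa only [h, true_imp_iff] using isOpen_dense_area h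
    · simp [h, dense_univ]
  have h2 : ∀ p : ι × ι × ι × ι × ι × ι, IsOpen {P : ι → Plane |
      [p.1, p.2.1, p.2.2.1, p.2.2.2.1, p.2.2.2.2.1, p.2.2.2.2.2].Nodup →
        concurrence (P p.1) (P p.2.1) (P p.2.2.1) (P p.2.2.2.1) (P p.2.2.2.2.1)
          (P p.2.2.2.2.2) ≠ 0} ∧ Dense {P : ι → Plane |
      [p.1, p.2.1, p.2.2.1, p.2.2.2.1, p.2.2.2.2.1, p.2.2.2.2.2].Nodup →
        concurrence (P p.1) (P p.2.1) (P p.2.2.1) (P p.2.2.2.1) (P p.2.2.2.2.1)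
          (P p.2.2.2.2.2) ≠ 0} := by
    rintro ⟨a, b, c, d, e, g⟩
    by_cases h : [a, b, c, d, e, g].Nodup
    · simpa only [h, true_imp_iff] using isOpen_dense_concurrence h
    · simp only [h, false_imp_iff]
      simp [dense_univ]
  have hd := (dense_iInter_of_isOpen (fun p => (h1 p).1) fun p => (h1 p).2).inter_of_isOpen_left
    (dense_iInter_of_isOpen (fun p => (h2 p).1) fun p => (h2 p).2)
    (isOpen_iInter_of_finite fun p => (h1 p).1)
  obtain ⟨P, ⟨hP1, hP2⟩, hP⟩ := hd.exists_dist_lt Q hε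
  rw [Set.mem_iInter] at hP1 hP2
  refine ⟨P, ⟨fun i j k => hP1 (i, j, k), fun a b c d e g => hP2 (a, b, c, d, e, g)⟩,
    fun i => ?_⟩
  rw [dist_comm]
  exact (dist_le_pi_dist Q P i).trans_lt hP

end Generic

/-! ### Piecewise linear drawings on a uniform grid -/

/-- The piecewise linear map on `[0, 1]` with value `g k` at `k / N`. -/
noncomputable def interpolate (N : ℕ) (g : ℕ → Plane) (t : ℝ) : Plane :=
  AffineMap.lineMap (g ⌊t * N⌋₊) (g (⌊t * N⌋₊ + 1)) (t * N - ⌊t * N⌋₊)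

theorem interpolate_eq {N : ℕ} (g : ℕ → Plane) {t : ℝ} {k : ℕ} (h1 : (k : ℝ) ≤ t * N)
    (h2 : t * N ≤ k + 1) :
    interpolate N g t = AffineMap.lineMap (g k) (g (k + 1)) (t * N - k) := by
  rcases h2.lt_or_eq with h | h
  · rw [interpolate, (Nat.floor_eq_iff ((Nat.cast_nonneg k).trans h1)).2 ⟨h1, h⟩]
  · have : ⌊t * N⌋₊ = k + 1 := by
      rw [h]; exact_mod_cast Nat.floor_natCast (R := ℝ) (k + 1)
    rw [interpolate, this, h]
    simp

theorem interpolate_node {N : ℕ} (hN : 0 < N) (g : ℕ → Plane) (k : ℕ) :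
    interpolate N g (k / N) = g k := by
  have : (k / N : ℝ) * N = k := by field_simp
  rw [interpolate_eq g (k := k) (by rw [this]) (by rw [this]; linarith), this]
  simp

theorem exists_piece {N : ℕ} (hN : 0 < N) {t : ℝ} (ht : t ∈ Set.Icc (0 : ℝ) 1) :
    ∃ k < N, (k : ℝ) ≤ t * N ∧ t * N ≤ k + 1 := by
  have hN' : (0 : ℝ) < N := Nat.cast_pos.2 hN
  have h0 : 0 ≤ t * N := mul_nonneg ht.1 hN'.le
  rcases ht.2.lt_or_eq with h | rfl
  · exact ⟨⌊t * N⌋₊, (Nat.floor_lt h0).2 (by nlinarith), Nat.floor_le h0,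
      (Nat.lt_floor_add_one _).le⟩
  · refine ⟨N - 1, by omega, ?_, ?_⟩ <;> rw [Nat.cast_sub hN] <;> simp

section Drawing

variable {V : Type*}

/-- The vertices of the subdivision of every edge into `N` pieces: the vertices of the graph, and
for every edge the interior division points. (Some indices are not used.) -/
abbrev Node (V : Type*) (N : ℕ) : Type _ := V ⊕ (Sym2 V × Fin (N + 1))

/-- The `k`-th division point of the edge `e`, for `k ≤ N`. -/
noncomputable def node (N : ℕ) (e : Sym2 V) (k : ℕ) : Node V N :=
  if k = 0 then Sum.inl (src e) else if k = N then Sum.inl (tgt e) else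
    Sum.inr (e, Fin.ofNat (N + 1) k)

theorem node_zero (N : ℕ) (e : Sym2 V) : node N e 0 = Sum.inl (src e) := if_pos rfl

theorem node_last {N : ℕ} (hN : 0 < N) (e : Sym2 V) : node N e N = Sum.inl (tgt e) := by
  simp [node, hN.ne']

variable [DecidableEq V]

/-- The point of the realization that corresponds to a node. -/
noncomputable def nodePoint (N : ℕ) : Node V N → V → ℝ
  | Sum.inl v => vertexPoint v
  | Sum.inr (e, k) => edgePoint e ((k : ℕ) / N)

theorem nodePoint_node {N : ℕ} (hN : 0 < N) (e : Sym2 V) {k : ℕ} (hk : k ≤ N) :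
    nodePoint N (node N e k) = edgePoint e (k / N) := by
  have hN' : (N : ℝ) ≠ 0 := Nat.cast_ne_zero.2 hN.ne'
  unfold node
  split_ifs with h1 h2
  · simp [nodePoint, h1, edgePoint_zero]
  · simp [nodePoint, h2, hN', edgePoint_one]
  · simp [nodePoint, Fin.ofNat, Nat.mod_eq_of_lt (Nat.lt_succ_of_le hk)]

theorem node_injOn {N : ℕ} (hN : 0 < N) {e : Sym2 V} (he : src e ≠ tgt e) {k l : ℕ} (hk : k ≤ N)
    (hl : l ≤ N) (h : node N e k = node N e l) : k = l := by
  have h' := congrArg (nodePoint N) h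
  rw [nodePoint_node hN e hk, nodePoint_node hN e hl] at h'
  have hN' : (N : ℝ) ≠ 0 := Nat.cast_ne_zero.2 hN.ne'
  have := edgePoint_injective he h'
  field_simp at this
  exact_mod_cast this

variable [Fintype V]

theorem div_mem_Icc {N k : ℕ} (hk : k ≤ N) : (k / N : ℝ) ∈ Set.Icc (0 : ℝ) 1 :=
  ⟨by positivity, div_le_one_of_le₀ (by exact_mod_cast hk) (by positivity)⟩

theorem node_ne {N : ℕ} (hN : 0 < N) {α β : Sym2 V} (hd : ∀ v ∈ α, v ∉ β) {k l : ℕ} (hk : k ≤ N)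
    (hl : l ≤ N) : node N α k ≠ node N β l := fun h => by
  have h' := congrArg (nodePoint N) h
  rw [nodePoint_node hN α hk, nodePoint_node hN β hl] at h'
  exact ne_of_mem_edgeSegment hd (edgePoint_mem (div_mem_Icc hk)) (edgePoint_mem (div_mem_Icc hl)) h'

/-- Maps of the edges that agree at common endpoints define a map of the realization. -/
theorem exists_drawing {G : SimpleGraph V} {p : V → Plane} {c : Sym2 V → ℝ → Plane}
    (h0 : ∀ e ∈ G.edgeSet, c e 0 = p (src e)) (h1 : ∀ e ∈ G.edgeSet, c e 1 = p (tgt e)) :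
    ∃ f : (V → ℝ) → Plane, (∀ v, f (vertexPoint v) = p v) ∧
      ∀ e ∈ G.edgeSet, ∀ t ∈ Set.Icc (0 : ℝ) 1, f (edgePoint e t) = c e t := by
  classical
  -- an edge is determined by any inner point
  have huniq : ∀ e ∈ G.edgeSet, ∀ t, t ≠ 0 → t ≠ 1 → ∀ e', edgePoint e t ∈ edgeSegment e' →
      e' = e := by
    intro e he t ht0 ht1 e' he'
    have hne := src_ne_tgt he
    have h1 : src e ∈ e' := by
      by_contra h
      have := he'.2 _ h
      simp [edgePoint_apply, hne] at this
      exact ht1 (by linarith)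
    have h2 : tgt e ∈ e' := by
      by_contra h
      have := he'.2 _ h
      simp [edgePoint_apply, hne.symm] at this
      exact ht0 this
    rw [(Sym2.mem_and_mem_iff hne).1 ⟨h1, h2⟩, mk_src_tgt]
  let f : (V → ℝ) → Plane := fun x =>
    if h : ∃ v, x = vertexPoint v then p h.choose else
      if h : ∃ e ∈ G.edgeSet, x ∈ edgeSegment e then c h.choose (x (tgt h.choose)) else 0
  have hv : ∀ v, f (vertexPoint v) = p v := fun v => by
    have h : ∃ w, (vertexPoint v : V → ℝ) = vertexPoint w := ⟨v, rfl⟩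
    simp only [f, dif_pos h]
    rw [← vertexPoint_injective h.choose_spec]
  refine ⟨f, hv, fun e he t ht => ?_⟩
  by_cases ht0 : t = 0
  · rw [ht0, edgePoint_zero, hv, h0 e he]
  by_cases ht1 : t = 1
  · rw [ht1, edgePoint_one, hv, h1 e he]
  have hnv : ¬∃ v, edgePoint e t = vertexPoint v := by
    rintro ⟨v, hv⟩
    have hne := src_ne_tgt he
    have e1 := congrFun hv (src e)
    have e2 := congrFun hv (tgt e)
    simp only [edgePoint_apply, vertexPoint, Pi.single_apply, hne, hne.symm, if_true,
      if_false] at e1 e2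
    split_ifs at e1 e2 with h3 h4
    · exact hne (h3.trans h4.symm)
    · exact ht0 (by linarith)
    · exact ht1 (by linarith)
    · exact ht0 (by linarith)
  have hex : ∃ e' ∈ G.edgeSet, edgePoint e t ∈ edgeSegment e' := ⟨e, he, edgePoint_mem ht⟩
  simp only [f, dif_neg hnv, dif_pos hex]
  rw [huniq e he t ht0 ht1 _ hex.choose_spec.2, edgePoint_apply_tgt (src_ne_tgt he)]

end Drawing

section Existence

variable {V : Type*} [DecidableEq V]

theorem lineMap_sub_eq {N : ℕ} {k : ℕ} (s t r : ℝ) :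
    AffineMap.lineMap s t r * N - k = AffineMap.lineMap (s * N - k) (t * N - k : ℝ) r := by
  simp [AffineMap.lineMap_apply]; ring

/-- An interpolating map is affine between two points of an edge that have no division point strictly
between them, since such points lie on one piece. -/
theorem apply_lineMap_of_lt {N : ℕ} (hN : 0 < N) {f : (V → ℝ) → Plane} {g : ℕ → Plane}
    {e : Sym2 V} (he : ∀ t ∈ Set.Icc (0 : ℝ) 1, f (edgePoint e t) = interpolate N g t) {s t : ℝ}
    (hs : s ∈ Set.Icc (0 : ℝ) 1) (ht : t ∈ Set.Icc (0 : ℝ) 1) (hst : s < t)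
    (hnot : ∀ k ≤ N, (k / N : ℝ) ∉ Set.Ioo s t) {τ : ℝ} (hτ : τ ∈ Set.Icc (0 : ℝ) 1) :
    f (AffineMap.lineMap (edgePoint e s) (edgePoint e t) τ) =
      AffineMap.lineMap (f (edgePoint e s)) (f (edgePoint e t)) τ := by
  have hN0 : (0 : ℝ) < N := Nat.cast_pos.2 hN
  -- `k / N` is the last division point that is not beyond `s`
  obtain ⟨k, hk1, hk2⟩ : ∃ k : ℕ, (k : ℝ) ≤ s * N ∧ s * N < k + 1 :=
    ⟨⌊s * N⌋₊, Nat.floor_le (mul_nonneg hs.1 hN0.le), Nat.lt_floor_add_one _⟩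
  have hkN : k < N := by
    have : (k : ℝ) < N := by nlinarith [ht.2]
    exact_mod_cast this
  have ht2 : t * N ≤ k + 1 := by
    by_contra! hlt
    refine hnot (k + 1) hkN ⟨?_, ?_⟩
    · rw [lt_div_iff₀ hN0]; push_cast; exact hk2
    · rw [div_lt_iff₀ hN0]; push_cast; exact hlt
  have hr := lineMap_mem_Icc hst.le hτ
  rw [← AffineMap.apply_lineMap, he _ ⟨hs.1.trans hr.1, hr.2.trans ht.2⟩, he s hs, he t ht,
    interpolate_eq g hk1 hk2.le, interpolate_eq g (k := k) (hk1.trans (by gcongr)) ht2,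
    interpolate_eq g (k := k) (hk1.trans (by gcongr; exact hr.1))
      (le_trans (by gcongr; exact hr.2) ht2), lineMap_sub_eq, AffineMap.apply_lineMap]

/-- The instances of genericity for three nodes on one edge. -/
theorem IsGeneric.area_node_ne_zero {G : SimpleGraph V} {N : ℕ} (hN : 0 < N) {P : Node V N → Plane}
    (hP : IsGeneric P) {e : Sym2 V} (he : e ∈ G.edgeSet) {i j k : ℕ} (hi : i ≤ N) (hj : j ≤ N)
    (hk : k ≤ N) (hij : i ≠ j) (hik : i ≠ k) (hjk : j ≠ k) :
    area (P (node N e i)) (P (node N e j)) (P (node N e k)) ≠ 0 := by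
  refine hP.area_ne_zero _ _ _ ?_
  simp only [List.nodup_cons, List.mem_cons, List.not_mem_nil, or_false, not_or, not_false_eq_true,
    List.nodup_nil, and_true]
  have hinj := @node_injOn V _ N hN e (src_ne_tgt he)
  exact ⟨⟨fun h => hij (hinj hi hj h), fun h => hik (hinj hi hk h)⟩,
    fun h => hjk (hinj hj hk h)⟩

variable [Fintype V]

/-- The instances of genericity for two nodes on an edge and one on a disjoint edge. -/
theorem IsGeneric.area_node_node_ne_zero {G : SimpleGraph V} {N : ℕ} (hN : 0 < N)
    {P : Node V N → Plane} (hP : IsGeneric P) {α β : Sym2 V} (hα : α ∈ G.edgeSet)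
    (hd : ∀ v ∈ α, v ∉ β) {i j k : ℕ} (hi : i ≤ N) (hj : j ≤ N) (hk : k ≤ N) (hij : i ≠ j) :
    area (P (node N α i)) (P (node N α j)) (P (node N β k)) ≠ 0 := by
  refine hP.area_ne_zero _ _ _ ?_
  simp only [List.nodup_cons, List.mem_cons, List.not_mem_nil, or_false, not_or, not_false_eq_true,
    List.nodup_nil, and_true]
  exact ⟨⟨fun h => hij (node_injOn hN (src_ne_tgt hα) hi hj h), node_ne hN hd hi hk⟩,
    node_ne hN hd hj hk⟩

/-- Distinct pieces of one edge have no common point with a piece of a disjoint edge. -/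
theorem IsGeneric.not_common_point {G : SimpleGraph V} {N : ℕ} (hN : 0 < N) {P : Node V N → Plane}
    (hP : IsGeneric P) {α β : Sym2 V} (hα : α ∈ G.edgeSet) (hβ : β ∈ G.edgeSet)
    (hd : ∀ v ∈ α, v ∉ β) {i i' j : ℕ} (hii : i < i') (hi' : i' < N) (hj : j < N) {z : Plane}
    (h1 : area (P (node N α i)) (P (node N α (i + 1))) z = 0)
    (h2 : area (P (node N α i')) (P (node N α (i' + 1))) z = 0)
    (h3 : area (P (node N β j)) (P (node N β (j + 1))) z = 0) : False := by
  have hd' : ∀ v ∈ β, v ∉ α := fun v h1 h2 => hd v h2 h1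
  rcases (Nat.succ_le_of_lt hii).eq_or_lt with h | h
  · -- adjacent pieces only share a division point, which is off the line of the piece of `β`
    obtain rfl : i' = i + 1 := h.symm
    have : z = P (node N α (i + 1)) := by
      refine eq_of_area_eq_zero ?_ h1 h2 (area_right _ _) (area_left _ _)
      rw [area_right]
      exact (hP.area_node_ne_zero hN hα (by omega) (by omega) (by omega) (by omega) (by omega)
        (by omega)).symm
    rw [this] at h3
    exact hP.area_node_node_ne_zero hN hβ hd' hj.le hj (show i + 1 ≤ N by omega) (by omega) h3
  · refine hP.concurrence_ne_zero _ _ _ _ _ _ ?_ (concurrence_eq_zero h1 h2 h3)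
    have n1 : ∀ k l : ℕ, k ≤ N → l ≤ N → k ≠ l → node N α k ≠ node N α l :=
      fun k l hk hl hkl h => hkl (node_injOn hN (src_ne_tgt hα) hk hl h)
    have n2 : node N β j ≠ node N β (j + 1) := fun h => by
      have := node_injOn hN (src_ne_tgt hβ) hj.le hj h
      omega
    have n3 : ∀ k l : ℕ, k ≤ N → l ≤ N → node N α k ≠ node N β l :=
      fun k l hk hl => node_ne hN hd hk hl
    simp only [List.nodup_cons, List.mem_cons, List.not_mem_nil, or_false, not_or,
      not_false_eq_true, List.nodup_nil, and_true]
    refine ⟨⟨n1 _ _ ?_ ?_ ?_, n1 _ _ ?_ ?_ ?_, n1 _ _ ?_ ?_ ?_, n3 _ _ ?_ ?_, n3 _ _ ?_ ?_⟩,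
      ⟨n1 _ _ ?_ ?_ ?_, n1 _ _ ?_ ?_ ?_, n3 _ _ ?_ ?_, n3 _ _ ?_ ?_⟩,
      ⟨n1 _ _ ?_ ?_ ?_, n3 _ _ ?_ ?_, n3 _ _ ?_ ?_⟩, ⟨n3 _ _ ?_ ?_, n3 _ _ ?_ ?_⟩, n2⟩ <;>
    omega

/-- The map that interpolates a generic family of points on a uniform grid is in general position. -/
theorem IsGeneric.isGeneralPL {G : SimpleGraph V} {N : ℕ} (hN : 0 < N) {P : Node V N → Plane}
    (hP : IsGeneric P) {f : (V → ℝ) → Plane} (hv : ∀ v, f (vertexPoint v) = P (Sum.inl v))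
    (he : ∀ e ∈ G.edgeSet, ∀ t ∈ Set.Icc (0 : ℝ) 1,
      f (edgePoint e t) = interpolate N (fun k => P (node N e k)) t) : IsGeneralPL G f := by
  have hN0 : (0 : ℝ) < N := Nat.cast_pos.2 hN
  refine ⟨⟨Set.range vertexPoint ∪ ⋃ e ∈ G.edgeSet, (fun k : ℕ => edgePoint e (k / N)) '' Set.Iic N,
    ?_, ?_, fun v => Or.inl ⟨v, rfl⟩, ?_, ?_⟩, ?_⟩
  · exact (Set.finite_range _).union (Set.Finite.biUnion (Set.toFinite _) fun e _ =>
      (Set.finite_Iic N).image _)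
  · refine Set.union_subset_union_right _ (Set.iUnion₂_mono fun e _ => ?_)
    rintro _ ⟨k, hk, rfl⟩
    exact edgePoint_mem (div_mem_Icc hk)
  · -- two points of an edge without a division point between them lie on one piece
    intro e hE x hx y hy hdisj τ hτ
    obtain ⟨s, hs, rfl⟩ : ∃ s ∈ Set.Icc (0 : ℝ) 1, edgePoint e s = x :=
      ⟨_, exists_edgePoint_eq (src_ne_tgt hE) hx⟩
    obtain ⟨t, ht, rfl⟩ : ∃ t ∈ Set.Icc (0 : ℝ) 1, edgePoint e t = y :=
      ⟨_, exists_edgePoint_eq (src_ne_tgt hE) hy⟩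
    have hnot : ∀ {s t : ℝ}, s < t → Disjoint (openSegment ℝ (edgePoint e s) (edgePoint e t))
        (Set.range vertexPoint ∪ ⋃ e ∈ G.edgeSet, (fun k : ℕ => edgePoint e (k / N)) '' Set.Iic N) →
        ∀ k ≤ N, (k / N : ℝ) ∉ Set.Ioo s t := by
      intro s t hst hdisj k hk hmem
      rw [openSegment_edgePoint e hst, Set.disjoint_left] at hdisj
      exact hdisj ⟨_, hmem, rfl⟩ (Or.inr (Set.mem_biUnion hE ⟨k, hk, rfl⟩))
    rcases lt_trichotomy s t with hst | rfl | hst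
    · exact apply_lineMap_of_lt hN (he e hE) hs ht hst (hnot hst hdisj) hτ
    · simp
    · rw [← AffineMap.lineMap_apply_one_sub, ← AffineMap.lineMap_apply_one_sub (f (edgePoint e t))]
      exact apply_lineMap_of_lt hN (he e hE) ht hs hst
        (hnot hst (by rwa [openSegment_symm])) ⟨by linarith [hτ.2], by linarith [hτ.1]⟩
  · -- distinct division points are images of distinct nodes
    have hnode : ∀ x ∈ Set.range vertexPoint ∪
        ⋃ e ∈ G.edgeSet, (fun k : ℕ => edgePoint e (k / N)) '' Set.Iic N,
        ∃ i, nodePoint N i = x ∧ f x = P i := by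
      rintro x (⟨v, rfl⟩ | hx)
      · exact ⟨Sum.inl v, rfl, hv v⟩
      · simp only [Set.mem_iUnion] at hx
        obtain ⟨e, hE, k, hk, rfl⟩ := hx
        refine ⟨node N e k, nodePoint_node hN e hk, ?_⟩
        simp only [he e hE _ (div_mem_Icc hk)]
        rw [interpolate_node hN]
    intro a ha b hb c hc hab hac hbc hcol
    obtain ⟨i, rfl, hi⟩ := hnode a ha
    obtain ⟨j, rfl, hj⟩ := hnode b hb
    obtain ⟨k, rfl, hk⟩ := hnode c hc
    rw [hi, hj, hk] at hcol
    refine hP.area_ne_zero i j k ?_ (area_eq_zero_of_collinear hcol)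
    simp only [List.nodup_cons, List.mem_cons, List.not_mem_nil, or_false, not_or,
      not_false_eq_true, List.nodup_nil, and_true]
    exact ⟨⟨fun h => hab (h ▸ rfl), fun h => hac (h ▸ rfl)⟩, fun h => hbc (h ▸ rfl)⟩
  · intro α hα β hβ hd x hx x' hx' y hy hxx' hxy
    obtain ⟨hs, hs'⟩ := exists_edgePoint_eq (src_ne_tgt hα) hx
    obtain ⟨ht, ht'⟩ := exists_edgePoint_eq (src_ne_tgt hα) hx'
    obtain ⟨hr, hr'⟩ := exists_edgePoint_eq (src_ne_tgt hβ) hy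
    generalize x (tgt α) = s at hs hs'
    generalize x' (tgt α) = t at ht ht'
    generalize y (tgt β) = r at hr hr'
    subst hs' ht' hr'
    obtain ⟨j, hj, hj1, hj2⟩ := exists_piece hN hr
    set z := f (edgePoint β r) with hz
    rw [he β hβ r hr, interpolate_eq _ hj1 hj2] at hz
    have hzβ : area (P (node N β j)) (P (node N β (j + 1))) z = 0 := by
      rw [hz]; exact area_lineMap_self _ _ _
    have hon : ∀ s ∈ Set.Icc (0 : ℝ) 1, f (edgePoint α s) = z → ∀ i : ℕ, (i : ℝ) ≤ s * N →
        s * N ≤ i + 1 →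
        z = AffineMap.lineMap (P (node N α i)) (P (node N α (i + 1))) (s * N - i) := by
      intro s hs hsz i hi1 hi2
      rw [← hsz, he α hα s hs, interpolate_eq _ hi1 hi2]
    obtain ⟨i, hi, hi1, hi2⟩ := exists_piece hN hs
    obtain ⟨i', hi', hi3, hi4⟩ := exists_piece hN ht
    have honα : ∀ s ∈ Set.Icc (0 : ℝ) 1, f (edgePoint α s) = z → ∀ i : ℕ, (i : ℝ) ≤ s * N →
        s * N ≤ i + 1 → area (P (node N α i)) (P (node N α (i + 1))) z = 0 := by
      intro s hs hsz i hi1 hi2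
      rw [hon s hs hsz i hi1 hi2]; exact area_lineMap_self _ _ _
    have htz : f (edgePoint α t) = z := hxx'.symm.trans hxy
    rcases lt_trichotomy i i' with h | rfl | h
    · exact (hP.not_common_point hN hα hβ hd h hi' hj (honα s hs hxy i hi1 hi2)
        (honα t ht htz i' hi3 hi4) hzβ).elim
    · have hne : P (node N α i) ≠ P (node N α (i + 1)) :=
        (ne_of_area_ne_zero
          (hP.area_node_node_ne_zero hN hα hd hi.le hi hj.le (by omega))).1
      have h1 := AffineMap.lineMap_injective ℝ hne
        ((hon s hs hxy i hi1 hi2).symm.trans (hon t ht htz i hi3 hi4))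
      have : s = t := mul_right_cancel₀ hN0.ne' (by linarith)
      rw [this]
    · exact (hP.not_common_point hN hα hβ hd h hi hj (honα t ht htz i' hi3 hi4)
        (honα s hs hxy i hi1 hi2) hzβ).elim

end Existence

/-! ### Drawing a graph along its strings -/

/-- The disjoint pairs of a finite family of compact sets have a common lower bound of the
distance. -/
theorem exists_lt_dist_of_disjoint {V : Type*} [Finite V] (K : V → Set Plane)
    (hK : ∀ v, IsCompact (K v)) :
    ∃ η > 0, ∀ v w, Disjoint (K v) (K w) → ∀ x ∈ K v, ∀ y ∈ K w, η < dist x y := by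
  have h : ∀ᶠ η : ℝ in nhdsWithin 0 (Set.Ioi 0), ∀ v w, Disjoint (K v) (K w) →
      ∀ x ∈ K v, ∀ y ∈ K w, η < dist x y := by
    refine Filter.eventually_all.2 fun v => Filter.eventually_all.2 fun w => ?_
    by_cases hd : Disjoint (K v) (K w)
    · obtain ⟨r, hr, hlt⟩ := Metric.exists_pos_forall_lt_edist (hK v) (hK w).isClosed hd
      filter_upwards [Ioo_mem_nhdsGT (show (0 : ℝ) < r from hr)] with η hη _ x hx y hy
      refine hη.2.trans ?_
      have := hlt x hx y hy
      rw [edist_dist, ← ENNReal.ofReal_coe_nnreal] at this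
      exact (ENNReal.ofReal_lt_ofReal_iff_of_nonneg r.2).1 this
    · exact Filter.Eventually.of_forall fun _ h => absurd h hd
  obtain ⟨η, h1, h2⟩ := (h.and self_mem_nhdsWithin).exists
  exact ⟨η, h2, h1⟩

/-- A fine uniform subdivision for a finite family of curves. -/
theorem exists_fine_subdivision {ι : Type*} [Fintype ι] (c : ι → ℝ → Plane)
    (hc : ∀ e, Continuous (c e)) {δ : ℝ} (hδ : 0 < δ) :
    ∃ N : ℕ, 0 < N ∧ ∀ e, ∀ k < N, dist (c e ((k + 1 : ℕ) / N)) (c e (k / N)) < δ := by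
  have hu : UniformContinuousOn (fun t e => c e t) (Set.Icc (0 : ℝ) 1) :=
    isCompact_Icc.uniformContinuousOn_of_continuous (continuous_pi hc).continuousOn
  obtain ⟨r, hr, h⟩ := Metric.uniformContinuousOn_iff.1 hu δ hδ
  obtain ⟨M, hM⟩ := exists_nat_one_div_lt hr
  refine ⟨M + 1, Nat.succ_pos M, fun e k hk => ?_⟩
  have h1 : dist (c e ((k + 1 : ℕ) / (M + 1 : ℕ))) (c e (k / (M + 1 : ℕ))) ≤
      dist (fun e => c e ((k + 1 : ℕ) / (M + 1 : ℕ))) (fun e => c e (k / (M + 1 : ℕ))) :=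
    dist_le_pi_dist (fun e => c e ((k + 1 : ℕ) / (M + 1 : ℕ)))
      (fun e => c e (k / (M + 1 : ℕ))) e
  refine h1.trans_lt (h _ (div_mem_Icc hk) _ (div_mem_Icc hk.le) ?_)
  rw [Real.dist_eq, ← sub_div, abs_of_nonneg] <;> push_cast
  · simpa using hM
  · simp; positivity

/-- Each edge of a graph with curves as in the definition of a string graph can be drawn inside the
union of the curves of its endpoints. -/
theorem exists_edge_curves {V : Type*} {G : SimpleGraph V} {γ : V → C(unitInterval, Plane)}
    (hγ : ∀ v w : V, G.Adj v w → (Set.range (γ v) ∩ Set.range (γ w)).Nonempty) :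
    ∃ c : Sym2 V → ℝ → Plane, (∀ e, Continuous (c e)) ∧ ∀ e ∈ G.edgeSet, c e 0 = γ (src e) 0 ∧
      c e 1 = γ (tgt e) 0 ∧ ∀ t, c e t ∈ Set.range (γ (src e)) ∪ Set.range (γ (tgt e)) := by
  have : PathConnectedSpace unitInterval := isPathConnected_iff_pathConnectedSpace.1
    ((convex_Icc (0 : ℝ) 1).isPathConnected ⟨0, by simp⟩)
  have h : ∀ e : Sym2 V, ∃ c : ℝ → Plane, Continuous c ∧ (e ∈ G.edgeSet → c 0 = γ (src e) 0 ∧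
      c 1 = γ (tgt e) 0 ∧ ∀ t, c t ∈ Set.range (γ (src e)) ∪ Set.range (γ (tgt e))) := by
    intro e
    by_cases he : e ∈ G.edgeSet
    · have hadj : G.Adj (src e) (tgt e) := by rwa [← mk_src_tgt e] at he
      have hconn := (isPathConnected_range (γ (src e)).continuous).union
        (isPathConnected_range (γ (tgt e)).continuous) (hγ _ _ hadj)
      have hj := hconn.joinedIn _ (Or.inl ⟨0, rfl⟩) _ (Or.inr ⟨0, rfl⟩)
      refine ⟨hj.somePath.extend, hj.somePath.continuous_extend, fun _ => ⟨by simp, by simp,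
        fun t => hj.somePath_mem (Set.projIcc 0 1 zero_le_one t)⟩⟩
    · exact ⟨fun _ => 0, continuous_const, fun h => absurd h he⟩
  choose c h1 h2 using h
  exact ⟨c, h1, h2⟩

/-- A string graph has a drawing in general position in which any two edges that form a pair in
`stringPairs G` have disjoint images: the drawing follows the curves of the vertices, and the curves
of the endpoints of one edge are disjoint from those of the other. -/
theorem IsStringGraph.exists_crossings_eq_empty {V : Type*} [DecidableEq V]
    [Fintype V] {G : SimpleGraph V} (hG : IsStringGraph G) :
    ∃ f, IsGeneralPL G f ∧ ∀ α β, (α, β) ∈ stringPairs G → crossings f α β = ∅ := by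
  obtain ⟨γ, hγ⟩ := hG
  obtain ⟨c, hc, hce⟩ := exists_edge_curves (G := G) (γ := γ) fun v w h => (hγ v w h.ne).2 h
  obtain ⟨η, hη, hdist⟩ := exists_lt_dist_of_disjoint (fun v => Set.range (γ v))
    fun v => isCompact_range (γ v).continuous
  obtain ⟨N, hN, hfine⟩ := exists_fine_subdivision c hc (show 0 < η / 4 by positivity)
  let Q : Node V N → Plane := Sum.elim (fun v => γ v 0) fun q => c q.1 ((q.2 : ℕ) / N)
  obtain ⟨P, hP, hPQ⟩ := exists_isGeneric Q (show 0 < η / 4 by positivity)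
  obtain ⟨f, hfv, hfe⟩ := exists_drawing (G := G) (p := fun v => P (Sum.inl v))
    (c := fun e => interpolate N fun k => P (node N e k))
    (fun e _ => by simpa [node_zero] using interpolate_node hN (fun k => P (node N e k)) 0)
    (fun e _ => by
      simpa [node_last hN, hN.ne'] using interpolate_node hN (fun k => P (node N e k)) N)
  refine ⟨f, hP.isGeneralPL hN hfv hfe, fun α β hp => ?_⟩
  have hQ : ∀ e ∈ G.edgeSet, ∀ k ≤ N, Q (node N e k) = c e (k / N) := by
    intro e he k hk
    have hN' : (N : ℝ) ≠ 0 := Nat.cast_ne_zero.2 hN.ne'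
    unfold node
    split_ifs with h1 h2
    · simp [Q, h1, (hce e he).1]
    · simp [Q, h2, hN', (hce e he).2.1]
    · simp [Q, Fin.ofNat, Nat.mod_eq_of_lt (Nat.lt_succ_of_le hk)]
  -- the drawing stays close to the curves
  have hclose : ∀ e ∈ G.edgeSet, ∀ x ∈ edgeSegment e,
      ∃ v ∈ e, ∃ q ∈ Set.range (γ v), dist (f x) q < η / 2 := by
    intro e he x hx
    obtain ⟨ht, htx⟩ := exists_edgePoint_eq (src_ne_tgt he) hx
    obtain ⟨k, hk, hk1, hk2⟩ := exists_piece hN ht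
    have hfx : f x ∈ Metric.ball (c e (k / N)) (η / 2) := by
      rw [← htx, hfe e he _ ht, interpolate_eq _ hk1 hk2]
      refine (convex_ball _ _).segment_subset (x := P (node N e k)) (y := P (node N e (k + 1)))
        ?_ ?_ ?_
      · have := hPQ (node N e k)
        rw [hQ e he k hk.le] at this
        rw [Metric.mem_ball]
        linarith
      · have h1 := hPQ (node N e (k + 1))
        rw [hQ e he _ hk] at h1
        have h2 := hfine e k hk
        rw [Metric.mem_ball]
        linarith [dist_triangle (P (node N e (k + 1))) (c e ((k + 1 : ℕ) / N)) (c e (k / N))]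
      · rw [segment_eq_image_lineMap]
        exact ⟨_, ⟨by linarith, by linarith⟩, rfl⟩
    rcases (hce e he).2.2 (k / N) with h | h
    · exact ⟨src e, src_mem e, _, h, hfx⟩
    · exact ⟨tgt e, tgt_mem e, _, h, hfx⟩
  rw [Set.eq_empty_iff_forall_notMem]
  rintro z ⟨⟨x, hx, rfl⟩, ⟨y, hy, hyx⟩⟩
  obtain ⟨v, hv, q, hq, hxq⟩ := hclose α hp.1 x hx
  obtain ⟨w, hw, q', hq', hyq⟩ := hclose β hp.2.1 y hy
  have hvw : v ≠ w := fun h => stringPairs_disjoint hp v hv (h ▸ hw)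
  have hdis : Disjoint (Set.range (γ v)) (Set.range (γ w)) := by
    rw [Set.disjoint_iff_inter_eq_empty, ← Set.not_nonempty_iff_eq_empty, hγ v w hvw]
    exact hp.2.2 v hv w hw
  have := hdist v w hdis q hq q' hq'
  rw [hyx] at hyq
  linarith [dist_triangle_left q q' (f x)]

end StringObstruction

theorem theorem3p2 {V : Type*} [Fintype V] [DecidableEq V] (G : SimpleGraph V)
    (hG : StringObstruction.IsStringGraph G) :
    StringObstruction.ObstructionVanishes G (StringObstruction.stringPairs G) ∧
      ∃ f : (V → ℝ) → StringObstruction.Plane, StringObstruction.IsGeneralPL G f ∧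
        ∀ α β : Sym2 V, (α, β) ∈ StringObstruction.stringPairs G →
          (StringObstruction.crossings f α β).Finite ∧
            Even (StringObstruction.crossings f α β).ncard := by
  obtain ⟨g, hg, hempty⟩ := hG.exists_crossings_eq_empty
  refine ⟨⟨⟨g, hg⟩, fun f hf => ?_⟩, g, hg, fun α β hp => by simp [hempty α β hp]⟩
  have hzero : StringObstruction.crossingVector (StringObstruction.stringPairs G) g = 0 := by
    funext p
    simp [StringObstruction.crossingVector, hempty _ _ p.2]
  rw [StringObstruction.vanKampenClass, Submodule.Quotient.mk_eq_zero]
  simpa [hzero] using hf.crossingVector_sub_mem hg
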